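/- Conventions. A *domain* $\Omega\subset\mathbb C^d$ is a non-empty connected open set. $\mathbb D$ is the open unit disc in $\mathbb C$, with Poincaré distance $p(a,b)=\tanh^{-1}\left|\frac{a-b}{1-\bar a b}\right|$. The Kobayashi pseudo-distance $K_\Omega(z,w)$ is the infimum of $\sum_{i=1}^n p(a_i,b_i)$ over all finite chains of holomorphic maps $\varphi_i:\mathbb D\to\Omega$ and points $a_i,b_i\in\mathbb D$ with $\varphi_1(a_1)=z$, $\varphi_i(b_i)=\varphi_{i+1}(a_{i+1})$ and $\varphi_n(b_n)=w$; the infinitesimal Kobayashi pseudo-metric is $k_\Omega(z;v)=\inf\{|\alpha| : \varphi:\mathbb D\to\Omega \text{ holomorphic},\ \varphi(0)=z,\ \alpha\varphi'(0)=v\}$. $\Omega$ is *Kobayashi hyperbolic* if $K_\Omega$ is a distance, and *complete Kobayashi hyperbolic* if moreover $(\Omega,K_\Omega)$ is Cauchy complete. $\overline\Omega^{End}$ denotes the end compactification of the closure $\overline\Omega$ of $\Omega$ in $\mathbb C^d$: the set $\overline\Omega$ together with its ends. An end $e$ assigns to every compact $K\subset\overline\Omega$ a quasi-component $e(K)$ of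 $\overline\Omega\setminus K$ such that $e(L)\subset e(K)$ whenever $K\subset L$. $\overline\Omega$ is an open subspace, and the sets $C\cup\{e' : e'(K)\subset C\}$, with $K\subset\overline\Omega$ compact and $C\supset e(K)$ open and closed in $\overline\Omega\setminus K$, form a neighbourhood base at $e$. (The quasi-component of a point is the intersection of the open-and-closed sets containing it. If the connected components of the sets $\overline\Omega\setminus K$ are open, e.g. if $\overline\Omega$ is locally connected, the quasi-components are the connected components, and one may take $C=e(K)$.) Put $\partial\overline\Omega^{End}=\overline\Omega^{End}\setminus\Omega$. For $\lambda\ge1$, $\kappa\ge0$, a *$(\lambda,\kappa)$-almost-geodesic* is an absolutely continuous curve $\sigma:[0,T]\to\Omega$ with $\lambda^{-1}|t-s|-\kappa\le K_\Omega(\sigma(t),\sigma(s))\le\lambda|t-s|+\kappa$ for all $s,t\in[0,T]$ and $k_\Omega(\sigma(t);\sigma'(t))\le\lambda$ for almost every $t$. $\Omega$ is a *visibility domain* if it is Kobayashi hyperbolic and, for all $\lambda\ge1$, $\kappa\ge0$, all distinct $\xi,\eta\in\partial\overline\Omega^{End}$ and all open neighbourhoods $V_\xi,V_\eta$ of $\xi,\eta$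 in $\overline\Omega^{End}$ with disjoint closures, there is a compact set $K\subset\Omega$ that meets every $(\lambda,\kappa)$-almost-geodesic $\sigma:[0,T]\to\Omega$ with $\sigma(0)\in V_\xi$ and $\sigma(T)\in V_\eta$. $\Omega$ *has well-behaved geodesics* if it is complete Kobayashi hyperbolic and, whenever $(z_n)$, $(w_n)$ are sequences in $\Omega$ that converge to the same point $\xi\in\partial\overline\Omega^{End}$ and $\sigma_n:[0,T_n]\to\Omega$ are geodesics for $K_\Omega$ (that is, $K_\Omega(\sigma_n(t),\sigma_n(s))=|t-s|$ for all $s,t$) from $w_n$ to $z_n$, one has $\lim_{n\to\infty}\inf_{t\in[0,T_n]}K_\Omega(o,\sigma_n(t))=+\infty$ for some (hence any) $o\in\Omega$. **Theorem.** Let $\Omega_1\subset\mathbb C^{d_1}$ and $\Omega_2\subset\mathbb C^{d_2}$ be domains such that $\Omega_1$ has well-behaved geodesics and $\Omega_2$ is a visibility domain. Let $f:\Omega_1\to\Omega_2$ be a continuous quasi-isometric embedding relative to the Kobayashi distances, i.e. $f$ is continuous and there are $\lambda\ge1$, $\kappa\ge0$ with $$\lambda^{-1}K_{\Omega_1}(z,w)-\kappa\le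 K_{\Omega_2}(f(z),f(w))\le\lambda K_{\Omega_1}(z,w)+\kappa\qquad(z,w\in\Omega_1).$$ Then $f$ extends to a continuous map $\overline{\Omega}_1^{End}\to\overline{\Omega}_2^{End}$. -/

import Mathlib

open Set Filter Topology MeasureTheory

/-! ### Ends and the end compactification of a topological space -/

section EndCompactification

variable {X : Type*} [TopologicalSpace X]

/-- For closed `K`: `C` is a subset of `X \ K` that is both open and closed in `X \ K`. -/
def IsClopenOff (K C : Set X) : Prop :=
  C ⊆ Kᶜ ∧ IsOpen C ∧ IsOpen (Kᶜ \ C)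

/-- The quasi-component of `x` in `X \ K`: the intersection of all sets that contain `x` and are
open and closed in `X \ K`. -/
def quasiComponentOff (K : Set X) (x : X) : Set X :=
  {y | ∀ C : Set X, IsClopenOff K C → x ∈ C → y ∈ C}

/-- Where the connected components of `X \ K` are open (for instance if `X` is locally connected),
the quasi-components of `X \ K` are exactly its connected components. -/
theorem quasiComponentOff_eq_connectedComponentIn {K : Set X}
    (hK : ∀ y ∈ Kᶜ, IsOpen (connectedComponentIn Kᶜ y)) {x : X} (hx : x ∈ Kᶜ) :
    quasiComponentOff K x = connectedComponentIn Kᶜ x := by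
  apply Subset.antisymm
  · intro y hy
    refine hy _ ⟨connectedComponentIn_subset _ _, hK x hx, ?_⟩ (mem_connectedComponentIn hx)
    rw [isOpen_iff_forall_mem_open]
    intro z hz
    refine ⟨connectedComponentIn Kᶜ z, ?_, hK z hz.1, mem_connectedComponentIn hz.1⟩
    intro w hw
    refine ⟨connectedComponentIn_subset _ _ hw, fun hw' => hz.2 ?_⟩
    rw [connectedComponentIn_eq hw', ← connectedComponentIn_eq hw]
    exact mem_connectedComponentIn hz.1
  · intro y hy C hC hxC
    by_contra hyC
    have hpre : IsPreconnected (connectedComponentIn Kᶜ x) := isPreconnected_connectedComponentIn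
    have hsub : connectedComponentIn Kᶜ x ⊆ C ∪ (Kᶜ \ C) := by
      intro z hz
      by_cases h : z ∈ C
      · exact Or.inl h
      · exact Or.inr ⟨connectedComponentIn_subset _ _ hz, h⟩
    obtain ⟨z, -, hz1, hz2⟩ := hpre C (Kᶜ \ C) hC.2.1 hC.2.2 hsub
      ⟨x, mem_connectedComponentIn hx, hxC⟩
      ⟨y, hy, connectedComponentIn_subset _ _ hy, hyC⟩
    exact hz2.2 hz1

variable (X) in
/-- An end of `X`: a choice, for every compact `K`, of a quasi-component of `X \ K`, decreasing
in `K`. -/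
@[ext]
structure SpaceEnd where
  /-- The chosen quasi-component of `X \ K`. -/
  part : TopologicalSpace.Compacts X → Set X
  exists_eq : ∀ K : TopologicalSpace.Compacts X, ∃ x ∈ (K : Set X)ᶜ, part K = quasiComponentOff (K : Set X) x
  anti : ∀ K L, K ≤ L → part L ⊆ part K

theorem SpaceEnd.subset_of_mem (e : SpaceEnd X) {K : TopologicalSpace.Compacts X} {C : Set X}
    (hC : IsClopenOff (K : Set X) C) {y : X} (hy : y ∈ e.part K) (hyC : y ∈ C) :
    e.part K ⊆ C := by
  obtain ⟨x, hx, he⟩ := e.exists_eq K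
  rw [he] at hy ⊢
  by_cases hxC : x ∈ C
  · exact fun z hz => hz C hC hxC
  · have h : IsClopenOff (K : Set X) ((K : Set X)ᶜ \ C) := by
      refine ⟨sdiff_subset, hC.2.2, ?_⟩
      rw [sdiff_sdiff_right_self]
      exact (inter_eq_self_of_subset_right hC.1).symm ▸ hC.2.1
    exact absurd hyC (hy _ h ⟨hx, hxC⟩).2

theorem SpaceEnd.part_nonempty (e : SpaceEnd X) (K : TopologicalSpace.Compacts X) :
    (e.part K).Nonempty := by
  obtain ⟨x, -, he⟩ := e.exists_eq K
  exact ⟨x, he ▸ fun C _ h => h⟩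

theorem IsClopenOff.inter [T2Space X] {K L : TopologicalSpace.Compacts X} {C D : Set X}
    (hC : IsClopenOff (K : Set X) C) (hD : IsClopenOff (L : Set X) D) :
    IsClopenOff ((K ⊔ L : TopologicalSpace.Compacts X) : Set X) (C ∩ D) := by
  have hK := K.isCompact.isClosed.isOpen_compl
  have hL := L.isCompact.isClosed.isOpen_compl
  refine ⟨?_, hC.2.1.inter hD.2.1, ?_⟩
  · rintro x ⟨h1, h2⟩
    simpa using ⟨hC.1 h1, hD.1 h2⟩
  · have : ((K ⊔ L : TopologicalSpace.Compacts X) : Set X)ᶜ \ (C ∩ D) =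
        (((K : Set X)ᶜ \ C) ∩ (L : Set X)ᶜ) ∪ ((K : Set X)ᶜ ∩ ((L : Set X)ᶜ \ D)) := by
      ext x
      simp only [TopologicalSpace.Compacts.coe_sup, Set.mem_sdiff, mem_compl_iff,
        mem_union, mem_inter_iff]
      tauto
    rw [this]
    exact (hC.2.2.inter hL).union (hK.inter hD.2.2)

variable (X) in
/-- The end compactification of `X`, as a set: the points of `X` together with the ends of `X`. -/
inductive EndCompactification where
  | pt (x : X) : EndCompactification
  | atEnd (e : SpaceEnd X) : EndCompactification

/-- The points of `X` in `C`, together with the ends of `X` that lie in `C` off `K`. -/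
def endNhd (K : TopologicalSpace.Compacts X) (C : Set X) : Set (EndCompactification X) :=
  EndCompactification.pt '' C ∪ EndCompactification.atEnd '' {e | e.part K ⊆ C}

/-- `X` is an open subspace, and the sets `endNhd K C`, where `K` is compact and `C` is open and
closed in `X \ K` with `e.part K ⊆ C`, are a neighbourhood base at the end `e`. If the connected
components of the sets `X \ K` are open, then `C = e.part K` is the smallest choice for given `K`. -/
instance [T2Space X] : TopologicalSpace (EndCompactification X) where
  IsOpen U := IsOpen (EndCompactification.pt ⁻¹' U) ∧
    ∀ e : SpaceEnd X, EndCompactification.atEnd e ∈ U →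
      ∃ (K : TopologicalSpace.Compacts X) (C : Set X),
        IsClopenOff (K : Set X) C ∧ e.part K ⊆ C ∧ endNhd K C ⊆ U
  isOpen_univ := ⟨by simp, fun e _ => ⟨⊥, univ, ⟨by simp, isOpen_univ, by simp⟩,
    subset_univ _, subset_univ _⟩⟩
  isOpen_inter U V hU hV := by
    refine ⟨hU.1.inter hV.1, fun e he => ?_⟩
    obtain ⟨K, C, hC, heC, hCU⟩ := hU.2 e he.1
    obtain ⟨L, D, hD, heD, hDV⟩ := hV.2 e he.2
    refine ⟨K ⊔ L, C ∩ D, hC.inter hD,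
      subset_inter ((e.anti _ _ le_sup_left).trans heC) ((e.anti _ _ le_sup_right).trans heD), ?_⟩
    rintro _ (⟨x, hx, rfl⟩ | ⟨e', he', rfl⟩)
    · exact ⟨hCU (Or.inl ⟨x, hx.1, rfl⟩), hDV (Or.inl ⟨x, hx.2, rfl⟩)⟩
    · obtain ⟨y, hy⟩ := e'.part_nonempty (K ⊔ L)
      exact ⟨hCU (Or.inr ⟨e', e'.subset_of_mem hC (e'.anti _ _ le_sup_left hy) (he' hy).1, rfl⟩),
        hDV (Or.inr ⟨e', e'.subset_of_mem hD (e'.anti _ _ le_sup_right hy) (he' hy).2, rfl⟩)⟩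
  isOpen_sUnion S hS := by
    refine ⟨?_, ?_⟩
    · rw [preimage_sUnion]
      exact isOpen_biUnion fun U hU => (hS U hU).1
    · rintro e ⟨U, hU, he⟩
      obtain ⟨K, C, hC, heC, hCU⟩ := (hS U hU).2 e he
      exact ⟨K, C, hC, heC, hCU.trans (subset_sUnion_of_mem hU)⟩

end EndCompactification

/-! ### Kobayashi geometry of domains in `ℂᵈ` -/

section Kobayashi

/-- `ℂᵈ` with the Euclidean norm. -/
abbrev CSpace (d : ℕ) : Type := EuclideanSpace ℂ (Fin d)

variable {d : ℕ}

/-- The Poincaré distance of the unit disc, normalized so that its infinitesimal form at `ζ` is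
`|v| / (1 - |ζ|²)`. -/
noncomputable def poincareDist (a b : ℂ) : ℝ :=
  Real.artanh ‖(a - b) / (1 - (starRingEnd ℂ) a * b)‖

/-- `φ` restricts to a holomorphic map from the open unit disc to `Ω`. -/
def IsHolDisc (Ω : Set (CSpace d)) (φ : ℂ → CSpace d) : Prop :=
  DifferentiableOn ℂ φ (Metric.ball 0 1) ∧ MapsTo φ (Metric.ball 0 1) Ω

/-- The infinitesimal Kobayashi pseudo-metric `k_Ω(z; v)`. -/
noncomputable def kobMetric (Ω : Set (CSpace d)) (z v : CSpace d) : ℝ :=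
  sInf {r : ℝ | ∃ (φ : ℂ → CSpace d) (α : ℂ),
    IsHolDisc Ω φ ∧ φ 0 = z ∧ α • deriv φ 0 = v ∧ r = ‖α‖}

/-- `L` is the total Poincaré length of a chain of holomorphic discs in `Ω` from `z` to `w`. -/
def IsChainLength (Ω : Set (CSpace d)) (z w : CSpace d) (L : ℝ) : Prop :=
  ∃ (n : ℕ) (x : ℕ → CSpace d) (φ : ℕ → ℂ → CSpace d) (a b : ℕ → ℂ),
    x 0 = z ∧ x n = w ∧
    (∀ i < n, IsHolDisc Ω (φ i) ∧ a i ∈ Metric.ball (0 : ℂ) 1 ∧ b i ∈ Metric.ball (0 : ℂ) 1 ∧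
      φ i (a i) = x i ∧ φ i (b i) = x (i + 1)) ∧
    L = ∑ i ∈ Finset.range n, poincareDist (a i) (b i)

/-- The Kobayashi pseudo-distance `K_Ω` of a domain `Ω`. -/
noncomputable def kobDist (Ω : Set (CSpace d)) (z w : Ω) : ℝ :=
  sInf {L : ℝ | IsChainLength Ω z w L}

/-- The pseudo-distance `K_Ω` is a distance. -/
def IsKobHyperbolic (Ω : Set (CSpace d)) : Prop :=
  ∀ z w : Ω, kobDist Ω z w = 0 → z = w

/-- `K_Ω` is a distance and `(Ω, K_Ω)` is Cauchy complete. -/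
def IsCompleteKobHyperbolic (Ω : Set (CSpace d)) : Prop :=
  IsKobHyperbolic Ω ∧
    ∀ u : ℕ → Ω, (∀ ε > 0, ∃ N, ∀ m ≥ N, ∀ n ≥ N, kobDist Ω (u m) (u n) < ε) →
      ∃ x : Ω, Tendsto (fun n => kobDist Ω (u n) x) atTop (𝓝 0)

/-- The restriction of `σ` to `[0, T]` is a `(lam, κ)`-almost-geodesic of `Ω`. -/
def IsAlmostGeodesic (Ω : Set (CSpace d)) (lam κ T : ℝ) (σ : ℝ → Ω) : Prop :=
  (∀ s ∈ Icc 0 T, ∀ t ∈ Icc 0 T,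
    lam⁻¹ * |t - s| - κ ≤ kobDist Ω (σ t) (σ s) ∧ kobDist Ω (σ t) (σ s) ≤ lam * |t - s| + κ) ∧
  AbsolutelyContinuousOnInterval (fun t => (σ t : CSpace d)) 0 T ∧
  ∀ᵐ t ∂(volume.restrict (Icc 0 T)),
    kobMetric Ω (σ t) (deriv (fun s => (σ s : CSpace d)) t) ≤ lam

/-- The restriction of `σ` to `[0, T]` is a geodesic of `(Ω, K_Ω)` from `w` to `z`. -/
def IsGeodesicSegment (Ω : Set (CSpace d)) (T : ℝ) (σ : ℝ → Ω) (w z : Ω) : Prop :=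
  0 ≤ T ∧ σ 0 = w ∧ σ T = z ∧
    ∀ s ∈ Icc 0 T, ∀ t ∈ Icc 0 T, kobDist Ω (σ t) (σ s) = |t - s|

/-- The end compactification of the closure of `Ω`. -/
abbrev ClosureEnd (Ω : Set (CSpace d)) : Type := EndCompactification (closure Ω)

/-- The inclusion of `Ω` into the end compactification of its closure. -/
def toClosureEnd (Ω : Set (CSpace d)) (z : Ω) : ClosureEnd Ω :=
  EndCompactification.pt ⟨z, subset_closure z.2⟩

/-- The complement of `Ω` in the end compactification of its closure. -/
def endBoundary (Ω : Set (CSpace d)) : Set (ClosureEnd Ω) :=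
  (range (toClosureEnd Ω))ᶜ

/-- `Ω` is a visibility domain with respect to the Kobayashi distance. -/
def IsVisibilityDomain (Ω : Set (CSpace d)) : Prop :=
  IsKobHyperbolic Ω ∧
    ∀ lam κ : ℝ, 1 ≤ lam → 0 ≤ κ →
    ∀ ξ ∈ endBoundary Ω, ∀ η ∈ endBoundary Ω, ξ ≠ η →
    ∀ V W : Set (ClosureEnd Ω), IsOpen V → IsOpen W → ξ ∈ V → η ∈ W →
      Disjoint (closure V) (closure W) →
      ∃ K : Set (CSpace d), IsCompact K ∧ K ⊆ Ω ∧
        ∀ (T : ℝ) (σ : ℝ → Ω), 0 ≤ T → IsAlmostGeodesic Ω lam κ T σ →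
          toClosureEnd Ω (σ 0) ∈ V → toClosureEnd Ω (σ T) ∈ W →
          ∃ t ∈ Icc 0 T, (σ t : CSpace d) ∈ K

/-- `Ω` is complete Kobayashi hyperbolic, and geodesic segments whose two end points converge to
one and the same point of the boundary of the end compactification escape to infinity. -/
def HasWellBehavedGeodesics (Ω : Set (CSpace d)) : Prop :=
  IsCompleteKobHyperbolic Ω ∧
    ∀ ξ ∈ endBoundary Ω, ∀ z w : ℕ → Ω,
      Tendsto (fun n => toClosureEnd Ω (z n)) atTop (𝓝 ξ) →
      Tendsto (fun n => toClosureEnd Ω (w n)) atTop (𝓝 ξ) →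
      ∀ (T : ℕ → ℝ) (σ : ℕ → ℝ → Ω), (∀ n, IsGeodesicSegment Ω (T n) (σ n) (w n) (z n)) →
        ∃ o : Ω, Tendsto (fun n => sInf ((fun t => kobDist Ω o (σ n t)) '' Icc 0 (T n)))
          atTop atTop

/-- `f` is a quasi-isometric embedding relative to the Kobayashi distances. -/
def IsKobQuasiIsometricEmbedding {d₁ d₂ : ℕ} (Ω₁ : Set (CSpace d₁)) (Ω₂ : Set (CSpace d₂))
    (f : Ω₁ → Ω₂) : Prop :=
  ∃ lam κ : ℝ, 1 ≤ lam ∧ 0 ≤ κ ∧ ∀ z w : Ω₁,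
    lam⁻¹ * kobDist Ω₁ z w - κ ≤ kobDist Ω₂ (f z) (f w) ∧
    kobDist Ω₂ (f z) (f w) ≤ lam * kobDist Ω₁ z w + κ

end Kobayashi

/-! ### Topology of the end compactification: regularity, compactness, countably generated traces.
-/

section EndTopology

open TopologicalSpace EndCompactification

variable {X : Type*} [TopologicalSpace X]

/-! The end compactification of the closure of Ω₂ is regular and Ω₁ is dense in its own, so it is
enough that f has a limit along the trace on Ω₁ of the neighbourhoods of each boundary point ξ.
Limits along ultrafilters exist by compactness (`exists_tendsto_pt`). They lie in the boundary,
because K_{Ω₁}(o, ·) tends to infinity at ξ and f distorts distances at most linearly. What remains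
is uniqueness, `IsKobQuasiIsometricEmbedding.not_separated`.

Were there two limits η ≠ ζ, some sequences w_n, z_n → ξ would have images near η and near ζ.
Geodesics from w_n to z_n exist by Hopf-Rinow, and their distance from o tends to infinity because
geodesics are well behaved. Their images are quasi-geodesics, but need not be absolutely continuous
or of bounded speed. Sampling them at integer times and joining the samples by almost minimal chains
of discs gives almost-geodesics with uniform constants at bounded distance
(`exists_almostGeodesic_near`). By visibility these meet a fixed compact set, so the image
quasi-geodesics come within bounded distance of f(o). By the lower quasi-isometry bound the
geodesics come within bounded distance of o, a contradiction.

Two preparations carry this. The Kobayashi distance is a length distance which induces the topology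
(chains of discs give paths, then Barth's theorem). The traces of neighbourhood filters are
countably generated, which allows sequences to replace filters, as the definition of well-behaved
geodesics requires. -/

theorem IsClopenOff.sdiff {K C : Set X} (hC : IsClopenOff K C) : IsClopenOff K (Kᶜ \ C) := by
  refine ⟨sdiff_subset, hC.2.2, ?_⟩
  rw [sdiff_sdiff_right_self]
  exact (inter_eq_self_of_subset_right hC.1).symm ▸ hC.2.1

theorem IsClopenOff.compl {K : Set X} (hK : IsClosed K) : IsClopenOff K Kᶜ :=
  ⟨Subset.rfl, hK.isOpen_compl, by simp⟩

theorem IsClopenOff.mono {K L C : Set X} (hC : IsClopenOff K C) (hKL : K ⊆ L) (hL : IsClosed L) :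
    IsClopenOff L (C \ L) := by
  refine ⟨fun x hx => hx.2, hC.2.1.sdiff hL, ?_⟩
  have : Lᶜ \ (C \ L) = (Kᶜ \ C) ∩ Lᶜ := by
    ext x
    simp only [Set.mem_sdiff, mem_compl_iff, mem_inter_iff]
    have := @hKL x
    tauto
  rw [this]
  exact hC.2.2.inter hL.isOpen_compl

/-- The rest of the complement of K is open and disjoint from C, so C can accumulate outside itself
only at K. -/
theorem IsClopenOff.closure_subset {K C : Set X} (hC : IsClopenOff K C) : closure C ⊆ C ∪ K := by
  intro x hx
  by_contra h
  simp only [mem_union, not_or] at h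
  obtain ⟨y, hy, hyC⟩ := mem_closure_iff.1 hx _ hC.2.2 ⟨h.2, h.1⟩
  exact hy.2 hyC

theorem SpaceEnd.part_subset_compl (e : SpaceEnd X) [T2Space X] (K : Compacts X) :
    e.part K ⊆ (K : Set X)ᶜ := by
  obtain ⟨x, hx, he⟩ := e.exists_eq K
  rw [he]
  exact fun y hy => hy _ (IsClopenOff.compl K.isCompact.isClosed) hx

/-- Quasi-components are never cut by clopen sets. This stands in for connectedness of the parts
throughout. -/
theorem SpaceEnd.subset_or (e : SpaceEnd X) [T2Space X] {K : Compacts X} {C : Set X}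
    (hC : IsClopenOff (K : Set X) C) : e.part K ⊆ C ∨ e.part K ⊆ (K : Set X)ᶜ \ C := by
  obtain ⟨x, hx⟩ := e.part_nonempty K
  by_cases h : x ∈ C
  · exact Or.inl (e.subset_of_mem hC hx h)
  · exact Or.inr (e.subset_of_mem hC.sdiff hx ⟨e.part_subset_compl K hx, h⟩)

/-- The part of an end is determined by any of its points. -/
theorem SpaceEnd.part_eq_of_mem (e : SpaceEnd X) [T2Space X] {K : Compacts X} {x : X}
    (hx : x ∈ e.part K) : e.part K = quasiComponentOff (K : Set X) x := by
  apply Subset.antisymm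
  · exact fun y hy C hC hxC => e.subset_of_mem hC hx hxC hy
  · intro y hy
    obtain ⟨z, hz, he⟩ := e.exists_eq K
    rw [he]
    intro C hC hzC
    refine hy C hC ?_
    rw [he] at hx
    exact hx C hC hzC

/-- If no clopen set tells the ends apart, each part of e lies in the corresponding part of e', and
quasi-components with a common point coincide. -/
theorem SpaceEnd.exists_separating [T2Space X] {e e' : SpaceEnd X} (h : e ≠ e') :
    ∃ (K : Compacts X) (C : Set X), IsClopenOff (K : Set X) C ∧ e.part K ⊆ C ∧
      e'.part K ⊆ (K : Set X)ᶜ \ C := by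
  by_contra! hcon
  apply h
  have key : ∀ K, e.part K ⊆ e'.part K := by
    intro K x hx
    obtain ⟨y, hy⟩ := e'.part_nonempty K
    rw [e'.part_eq_of_mem hy]
    intro C hC hyC
    by_contra hxC
    have hxD : x ∈ (K : Set X)ᶜ \ C := ⟨e.part_subset_compl K hx, hxC⟩
    refine hcon K _ hC.sdiff (e.subset_of_mem hC.sdiff hx hxD) ?_
    rw [sdiff_sdiff_right_self, inter_eq_self_of_subset_right hC.1]
    exact e'.subset_of_mem hC hy hyC
  ext K : 2
  obtain ⟨x, hx⟩ := e.part_nonempty K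
  rw [e.part_eq_of_mem hx, e'.part_eq_of_mem (key K hx)]

@[simp]
theorem pt_mem_endNhd {K : Compacts X} {C : Set X} {x : X} : pt x ∈ endNhd K C ↔ x ∈ C := by
  simp [endNhd]

@[simp]
theorem atEnd_mem_endNhd {K : Compacts X} {C : Set X} {e : SpaceEnd X} :
    atEnd e ∈ endNhd K C ↔ e.part K ⊆ C := by
  simp [endNhd]

variable [T2Space X]

theorem isOpen_endCompactification_iff {U : Set (EndCompactification X)} :
    IsOpen U ↔ IsOpen (pt ⁻¹' U) ∧ ∀ e : SpaceEnd X, atEnd e ∈ U →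
      ∃ (K : Compacts X) (C : Set X), IsClopenOff (K : Set X) C ∧ e.part K ⊆ C ∧ endNhd K C ⊆ U :=
  Iff.rfl

theorem isOpen_endNhd {K : Compacts X} {C : Set X} (hC : IsClopenOff (K : Set X) C) :
    IsOpen (endNhd K C) := by
  refine isOpen_endCompactification_iff.2 ⟨?_, fun e he => ⟨K, C, hC, by simpa using he, Subset.rfl⟩⟩
  convert hC.2.1
  ext x
  simp

theorem continuous_pt : Continuous (pt : X → EndCompactification X) :=
  ⟨fun _ hU => hU.1⟩

theorem isOpenEmbedding_pt : IsOpenEmbedding (pt : X → EndCompactification X) := by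
  refine IsOpenEmbedding.of_continuous_injective_isOpenMap continuous_pt
    (fun x y h => by injection h) fun U hU => isOpen_endCompactification_iff.2 ⟨?_, ?_⟩
  · rwa [preimage_image_eq]
    exact fun x y h => by injection h
  · rintro e ⟨x, -, hx⟩
    cases hx

theorem mem_nhds_atEnd {e : SpaceEnd X} {U : Set (EndCompactification X)} :
    U ∈ 𝓝 (atEnd e) ↔ ∃ (K : Compacts X) (C : Set X), IsClopenOff (K : Set X) C ∧
      e.part K ⊆ C ∧ endNhd K C ⊆ U := by
  constructor
  · intro h
    obtain ⟨V, hVU, hV, he⟩ := mem_nhds_iff.1 h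
    obtain ⟨K, C, hC, heC, hCV⟩ := hV.2 e he
    exact ⟨K, C, hC, heC, hCV.trans hVU⟩
  · rintro ⟨K, C, hC, heC, hCU⟩
    exact mem_of_superset ((isOpen_endNhd hC).mem_nhds (by simpa using heC)) hCU

theorem denseRange_pt : DenseRange (pt : X → EndCompactification X) := by
  intro z
  cases z with
  | pt x => exact subset_closure (mem_range_self x)
  | atEnd e =>
    rw [mem_closure_iff_nhds]
    intro U hU
    obtain ⟨K, C, hC, heC, hCU⟩ := mem_nhds_atEnd.1 hU
    obtain ⟨x, hx⟩ := e.part_nonempty K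
    exact ⟨pt x, hCU (by simpa using heC hx), mem_range_self x⟩

theorem isClosed_pt_image {K : Set X} (hK : IsCompact K) :
    IsClosed (pt '' K : Set (EndCompactification X)) := by
  rw [← isOpen_compl_iff, isOpen_endCompactification_iff]
  constructor
  · convert hK.isClosed.isOpen_compl
    ext x
    simp
  · intro e _
    refine ⟨⟨K, hK⟩, Kᶜ, IsClopenOff.compl hK.isClosed, e.part_subset_compl ⟨K, hK⟩, ?_⟩
    rintro _ (⟨x, hx, rfl⟩ | ⟨e', he', rfl⟩)
    · simpa using hx
    · simp

/-- Together with regularity this yields T3, so the Hausdorff property needs no separate proof. -/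
instance EndCompactification.instT0Space : T0Space (EndCompactification X) := by
  refine ⟨fun {z w} h => ?_⟩
  rw [inseparable_iff_forall_isOpen] at h
  cases z with
  | pt x =>
    cases w with
    | pt y =>
      by_contra hne
      have := (h _ (isClosed_pt_image (isCompact_singleton (x := x))).isOpen_compl)
      simp at this
      exact hne (by rw [this])
    | atEnd e => simpa using h _ (isClosed_pt_image (isCompact_singleton (x := x))).isOpen_compl
  | atEnd e =>
    cases w with
    | pt y => simpa using h _ (isClosed_pt_image (isCompact_singleton (x := y))).isOpen_compl
    | atEnd e' =>
      by_contra hne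
      obtain ⟨K, C, hC, h1, h2⟩ :=
        SpaceEnd.exists_separating (e := e) (e' := e') (fun h => hne (by rw [h]))
      have h3 : e'.part K ⊆ C :=
        atEnd_mem_endNhd.1 ((h _ (isOpen_endNhd hC)).1 (atEnd_mem_endNhd.2 h1))
      obtain ⟨x, hx⟩ := e'.part_nonempty K
      exact (h2 hx).2 (h3 hx)

/-- At a point, compact neighbourhoods are closed. At an end, a basic set C off K is shrunk to C \
L, where the compact L has K in its interior. -/
instance EndCompactification.instRegularSpace [LocallyCompactSpace X] :
    RegularSpace (EndCompactification X) := by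
  refine RegularSpace.of_exists_mem_nhds_isClosed_subset fun z U hU => ?_
  cases z with
  | pt x =>
    have : pt ⁻¹' U ∈ 𝓝 x := continuous_pt.continuousAt hU
    obtain ⟨K, hKx, hKU, hK⟩ := local_compact_nhds this
    exact ⟨pt '' K, isOpenEmbedding_pt.image_mem_nhds.2 hKx, isClosed_pt_image hK,
      image_subset_iff.2 hKU⟩
  | atEnd e =>
    obtain ⟨K, C, hC, heC, hCU⟩ := mem_nhds_atEnd.1 hU
    obtain ⟨L, hL, hKL⟩ := exists_compact_superset K.isCompact
    have hKL' : (K : Set X) ⊆ L := hKL.trans interior_subset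
    refine ⟨closure (endNhd ⟨L, hL⟩ (C \ L)), ?_, isClosed_closure, ?_⟩
    · refine mem_of_superset (mem_nhds_atEnd.2 ⟨⟨L, hL⟩, _, hC.mono hKL' hL.isClosed, ?_, Subset.rfl⟩)
        subset_closure
      exact subset_sdiff.2 ⟨(e.anti K ⟨L, hL⟩ hKL').trans heC,
        disjoint_left.2 (e.part_subset_compl ⟨L, hL⟩)⟩
    · refine Subset.trans ?_ hCU
      intro w hw
      rw [mem_closure_iff] at hw
      cases w with
      | pt y =>
        rw [pt_mem_endNhd]
        have hy : y ∈ closure (C \ L) := by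
          rw [mem_closure_iff]
          intro V hV hyV
          obtain ⟨_, ⟨v, hv, rfl⟩, h2⟩ := hw _ (isOpenEmbedding_pt.isOpenMap V hV) ⟨y, hyV, rfl⟩
          exact ⟨v, hv, by simpa using h2⟩
        -- C can gain only points of K in its closure, and these lie in the interior of L, out of
        -- reach of C \ L.
        rcases hC.closure_subset (closure_mono sdiff_subset hy) with h | h
        · exact h
        · obtain ⟨v, hv1, hv2⟩ := mem_closure_iff.1 hy _ isOpen_interior (hKL h)
          exact absurd (interior_subset hv1) hv2.2
      | atEnd e' =>
        rw [atEnd_mem_endNhd]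
        rcases e'.subset_or hC with h | h
        · exact h
        · obtain ⟨v, hv1, hv2⟩ := hw _ (isOpen_endNhd hC.sdiff) (by simpa using h)
          exfalso
          cases v with
          | pt y => exact ((pt_mem_endNhd.1 hv1).2 (pt_mem_endNhd.1 hv2).1)
          | atEnd e'' =>
            obtain ⟨x, hx⟩ := e''.part_nonempty ⟨L, hL⟩
            exact (atEnd_mem_endNhd.1 hv1 (e''.anti K ⟨L, hL⟩ hKL' hx)).2
              (atEnd_mem_endNhd.1 hv2 hx).1

/-- In a connected space, a set which is clopen off `K` and reaches out of a larger compact set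
meets its frontier. -/
theorem IsClopenOff.inter_frontier_nonempty [ConnectedSpace X] {K L C : Set X}
    (hC : IsClopenOff K C) (hL : IsCompact L) (hKL : K ⊆ interior L) (hne : L.Nonempty)
    (h : (C \ L).Nonempty) : (C ∩ frontier L).Nonempty := by
  by_contra hcon
  -- If C missed the frontier, C \ L would be clopen in the whole connected space, hence empty or
  -- everything; `hne` excludes the latter.
  have hclosed : IsClosed (C \ L) := by
    rw [← closure_subset_iff_isClosed]
    intro x hx
    have hxC : x ∈ C := by
      rcases hC.closure_subset (closure_mono sdiff_subset hx) with h | h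
      · exact h
      · obtain ⟨v, hv1, hv2⟩ := mem_closure_iff.1 hx _ isOpen_interior (hKL h)
        exact absurd (interior_subset hv1) hv2.2
    refine ⟨hxC, fun hxL => hcon ⟨x, hxC, subset_closure hxL, fun hxi => ?_⟩⟩
    obtain ⟨v, hv1, hv2⟩ := mem_closure_iff.1 hx _ isOpen_interior hxi
    exact absurd (interior_subset hv1) hv2.2
  rcases isClopen_iff.1 ⟨hclosed, hC.2.1.sdiff hL.isClosed⟩ with h0 | h0
  · exact h.ne_empty h0
  · obtain ⟨x, hx⟩ := hne
    exact (h0.symm ▸ mem_univ x : x ∈ C \ L).2 hx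

/-- An ultrafilter that leaves every compact set of a connected space converges to an end. -/
theorem exists_tendsto_pt_atEnd [ConnectedSpace X] [LocallyCompactSpace X] (U : Ultrafilter X)
    (hU : ∀ K : Set X, IsCompact K → Kᶜ ∈ U) :
    ∃ e : SpaceEnd X, Tendsto pt (U : Filter X) (𝓝 (atEnd e)) := by
  -- The candidate end: for each K, the intersection of all clopen sets off K that belong to the
  -- ultrafilter.
  let P : Compacts X → Set X := fun K => {x | ∀ C, IsClopenOff (K : Set X) C → C ∈ U → x ∈ C}
  have hdich : ∀ (K : Compacts X) (C : Set X), C ∉ U → (K : Set X)ᶜ \ C ∈ U := fun K C h =>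
    inter_mem (hU _ K.isCompact) (Ultrafilter.compl_mem_iff_notMem.2 h)
  have hne : ∀ K, (P K).Nonempty := by
    intro K
    obtain ⟨x₀⟩ := (inferInstance : Nonempty X)
    obtain ⟨L, hL, hKL⟩ := exists_compact_superset (K.isCompact.union (isCompact_singleton (x := x₀)))
    have hKL' := subset_union_left.trans hKL
    have hx₀ : L.Nonempty := ⟨x₀, interior_subset (hKL (Or.inr rfl))⟩
    have hfr : IsCompact (frontier L) :=
      hL.of_isClosed_subset isClosed_frontier hL.isClosed.frontier_subset
    let S := {C : Set X // IsClopenOff (K : Set X) C ∧ C ∈ U}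
    have hmem : ∀ C : Set X, IsClopenOff (K : Set X) C → C ∈ U → (frontier L ∩ C).Nonempty := by
      intro C hC hCU
      rw [inter_comm]
      exact hC.inter_frontier_nonempty hL hKL' hx₀ (U.nonempty_of_mem (inter_mem hCU (hU L hL)))
    -- The sets in question are stable under finite intersections and all meet the compact frontier
    -- of L, so their closures share a point there. That point is off K, hence in the sets
    -- themselves.
    have hfin : (frontier L ∩ ⋂ C : S, closure C.1).Nonempty := by
      refine hfr.inter_iInter_nonempty _ (fun C => isClosed_closure) fun u => ?_
      have : ∃ D : Set X, IsClopenOff (K : Set X) D ∧ D ∈ U ∧ D ⊆ ⋂ C ∈ u, C.1 := by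
        classical
        induction u using Finset.induction_on with
        | empty => exact ⟨_, IsClopenOff.compl K.isCompact.isClosed, hU _ K.isCompact, by simp⟩
        | insert C u _ ih =>
          obtain ⟨D, hD, hDU, hDu⟩ := ih
          refine ⟨C.1 ∩ D, by simpa using C.2.1.inter hD, inter_mem C.2.2 hDU, ?_⟩
          rw [Finset.set_biInter_insert]
          exact inter_subset_inter_right _ hDu
      obtain ⟨D, hD, hDU, hDu⟩ := this
      refine (hmem D hD hDU).mono (inter_subset_inter_right _ (hDu.trans ?_))
      exact iInter₂_mono fun C _ => subset_closure
    obtain ⟨x, hxL, hx⟩ := hfin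
    refine ⟨x, fun C hC hCU => ?_⟩
    rcases hC.closure_subset (mem_iInter.1 hx ⟨C, hC, hCU⟩) with h | h
    · exact h
    · exact absurd (hKL' h) hxL.2
  let e : SpaceEnd X :=
    { part := P
      exists_eq := by
        intro K
        obtain ⟨x, hx⟩ := hne K
        refine ⟨x, hx _ (IsClopenOff.compl K.isCompact.isClosed) (hU _ K.isCompact), ?_⟩
        -- Either C or its complement off K belongs to U, so whether x lies in C decides whether C
        -- belongs to U.
        apply Subset.antisymm
        · intro y hy C hC hxC
          refine hy C hC ?_
          by_contra hCU
          exact (hx _ hC.sdiff (hdich K C hCU)).2 hxC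
        · exact fun y hy C hC hCU => hy C hC (hx C hC hCU)
      anti := by
        intro K L hKL x hx C hC hCU
        exact (hx _ (hC.mono hKL L.isCompact.isClosed) (inter_mem hCU (hU _ L.isCompact))).1 }
  refine ⟨e, fun V hV => ?_⟩
  obtain ⟨K, C, hC, heC, hCV⟩ := mem_nhds_atEnd.1 hV
  have hCU : C ∈ U := by
    by_contra hCU
    obtain ⟨x, hx⟩ := hne K
    exact (hx _ hC.sdiff (hdich K C hCU)).2 (heC hx)
  exact mem_map.2 (mem_of_superset hCU fun x hx => hCV (pt_mem_endNhd.2 hx))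

/-- Compactness, in the only form needed: an ultrafilter either contains a compact set or escapes to
an end. -/
theorem exists_tendsto_pt [ConnectedSpace X] [LocallyCompactSpace X] (U : Ultrafilter X) :
    ∃ z : EndCompactification X, Tendsto pt (U : Filter X) (𝓝 z) := by
  by_cases h : ∀ K : Set X, IsCompact K → Kᶜ ∈ U
  · obtain ⟨e, he⟩ := exists_tendsto_pt_atEnd U h
    exact ⟨_, he⟩
  · push Not at h
    obtain ⟨K, hK, hKU⟩ := h
    obtain ⟨x, -, hx⟩ := hK.ultrafilter_le_nhds U (le_principal_iff.2 (Ultrafilter.compl_notMem_iff.1 hKU))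
    exact ⟨pt x, (continuous_pt.tendsto x).mono_left hx⟩

/-- The quasi-component chosen by an end is a countable intersection of clopen sets. -/
theorem SpaceEnd.exists_countable_clopen [SecondCountableTopology X] (e : SpaceEnd X)
    (K : Compacts X) : ∃ S : Set (Set X), S.Countable ∧
      (∀ C ∈ S, IsClopenOff (K : Set X) C ∧ e.part K ⊆ C) ∧ ⋂₀ S ∩ (K : Set X)ᶜ ⊆ e.part K := by
  let T := {C : Set X | IsClopenOff (K : Set X) C ∧ e.part K ⊆ C}
  -- Lindelöf: countably many of the open complements have the same union as all of them.
  obtain ⟨S, hST, hS, hSU⟩ := isOpen_biUnion_countable T (fun C => (K : Set X)ᶜ \ C)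
    fun C hC => hC.1.2.2
  refine ⟨S, hS, fun C hC => hST hC, ?_⟩
  rintro x ⟨hxS, hxK⟩
  obtain ⟨y, hy⟩ := e.part_nonempty K
  rw [e.part_eq_of_mem hy]
  intro C hC hyC
  by_contra hxC
  have hx : x ∈ ⋃ C ∈ T, (K : Set X)ᶜ \ C :=
    mem_biUnion (show C ∈ T from ⟨hC, e.subset_of_mem hC hy hyC⟩) ⟨hxK, hxC⟩
  rw [← hSU] at hx
  obtain ⟨D, hD, hxD⟩ := mem_iUnion₂.1 hx
  exact hxD.2 (hxS D hD)

theorem compl_mem_comap_pt_atEnd (e : SpaceEnd X) {K : Set X} (hK : IsCompact K) :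
    Kᶜ ∈ comap pt (𝓝 (atEnd e)) :=
  ⟨_, mem_nhds_atEnd.2 ⟨⟨K, hK⟩, _, IsClopenOff.compl hK.isClosed,
    e.part_subset_compl ⟨K, hK⟩, Subset.rfl⟩, fun _ hx => pt_mem_endNhd.1 hx⟩

/-- The trace on `X` of the neighbourhood filter of an end is countably generated. -/
theorem isCountablyGenerated_comap_pt_atEnd [ConnectedSpace X] [LocallyCompactSpace X]
    [SecondCountableTopology X] (e : SpaceEnd X) :
    (comap pt (𝓝 (atEnd e))).IsCountablyGenerated := by
  let E : CompactExhaustion X := default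
  let K : ℕ → Compacts X := fun n => ⟨E n, E.isCompact n⟩
  choose S hS hS1 hS2 using fun n => e.exists_countable_clopen (K n)
  refine ⟨⋃ n, insert ((K n : Set X)ᶜ) (S n), countable_iUnion fun n => (hS n).insert _, ?_⟩
  apply le_antisymm
  · rw [le_generate_iff]
    refine iUnion_subset fun n => insert_subset (compl_mem_comap_pt_atEnd e (K n).isCompact) ?_
    intro C hC
    exact ⟨_, mem_nhds_atEnd.2 ⟨K n, C, (hS1 n C hC).1, (hS1 n C hC).2, Subset.rfl⟩,
      fun _ hx => pt_mem_endNhd.1 hx⟩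
  -- No neighbourhood is compared with generators by hand: an ultrafilter containing the generators
  -- leaves every compact set, so it converges to some end, and the generators allow only e.
  · rw [le_iff_ultrafilter]
    intro U hU
    have hmem : ∀ n, ∀ C ∈ insert ((K n : Set X)ᶜ) (S n), C ∈ U := fun n C hC =>
      hU (mem_generate_of_mem (mem_iUnion.2 ⟨n, hC⟩))
    have hsup : ∀ L : Set X, IsCompact L → ∃ n, L ⊆ K n := fun L hL => by
      obtain ⟨n, hn⟩ := E.exists_superset_of_isCompact hL
      exact ⟨n, hn⟩
    obtain ⟨e', he'⟩ := exists_tendsto_pt_atEnd U fun L hL => by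
      obtain ⟨n, hn⟩ := hsup L hL
      exact mem_of_superset (hmem n _ (mem_insert _ _)) (compl_subset_compl.2 hn)
    have hee : e' = e := by
      by_contra hne
      obtain ⟨L, C, hC, h1, h2⟩ := SpaceEnd.exists_separating hne
      obtain ⟨n, hn⟩ := hsup L L.isCompact
      obtain ⟨x, hx⟩ := e'.part_nonempty (K n)
      have hxe : x ∈ e.part (K n) := by
        refine hS2 n ⟨fun D hD => ?_, e'.part_subset_compl _ hx⟩
        rcases e'.subset_or (hS1 n D hD).1 with h | h
        · exact h hx
        · have : (K n : Set X)ᶜ \ D ∈ U := mem_of_superset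
            (he' ((isOpen_endNhd (hS1 n D hD).1.sdiff).mem_nhds (atEnd_mem_endNhd.2 h)))
            fun y hy => pt_mem_endNhd.1 hy
          obtain ⟨y, hy, hyD⟩ := U.nonempty_of_mem (inter_mem this (hmem n D (mem_insert_of_mem _ hD)))
          exact absurd hyD hy.2
      exact (h2 (e.anti L (K n) hn hxe)).2 (h1 (e'.anti L (K n) hn hx))
    rw [← tendsto_iff_comap, ← hee]
    exact he'

theorem isCountablyGenerated_comap_pt [ConnectedSpace X] [LocallyCompactSpace X]
    [SecondCountableTopology X] (z : EndCompactification X) :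
    (comap pt (𝓝 z)).IsCountablyGenerated := by
  cases z with
  | pt x =>
    rw [← isOpenEmbedding_pt.isInducing.nhds_eq_comap]
    infer_instance
  | atEnd e => exact isCountablyGenerated_comap_pt_atEnd e

end EndTopology

/-! ### Complete locally compact length spaces: Hopf-Rinow and geodesics. -/

section LengthSpace

/-- Any two points of `X` are joined by `1`-Lipschitz paths whose length is arbitrarily close to
their distance. -/
def HasAlmostMinimalPaths (X : Type*) [PseudoMetricSpace X] : Prop :=
  ∀ (x y : X) (ε : ℝ), 0 < ε → ∃ (l : ℝ) (γ : ℝ → X), 0 ≤ l ∧ l < dist x y + ε ∧ γ 0 = x ∧ γ l = y ∧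
    ∀ s ∈ Icc 0 l, ∀ t ∈ Icc 0 l, dist (γ s) (γ t) ≤ |s - t|

variable {X : Type*} [MetricSpace X]

theorem HasAlmostMinimalPaths.exists_near (hX : HasAlmostMinimalPaths X) {x y : X} {r ε : ℝ}
    (hr : 0 ≤ r) (hε : 0 < ε) (h : dist x y < r + ε) : ∃ m, dist x m ≤ r ∧ dist m y < ε := by
  obtain ⟨l, γ, hl, hlt, h0, h1, hγ⟩ := hX x y _ (sub_pos.2 h)
  have hm : min r l ∈ Icc 0 l := ⟨le_min hr hl, min_le_right _ _⟩
  refine ⟨γ (min r l), ?_, ?_⟩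
  · have := hγ 0 ⟨le_rfl, hl⟩ _ hm
    rw [h0, zero_sub, abs_neg, abs_of_nonneg hm.1] at this
    exact this.trans (min_le_left _ _)
  · have := hγ _ hm l ⟨hl, le_rfl⟩
    rw [h1, abs_of_nonpos (by linarith [hm.2])] at this
    refine this.trans_lt ?_
    rcases min_cases r l with ⟨h, -⟩ | ⟨h, -⟩ <;> rw [h] <;> linarith

/-- **Hopf-Rinow**: a complete locally compact length space is proper. -/
theorem HasAlmostMinimalPaths.properSpace [CompleteSpace X] [LocallyCompactSpace X]
    (hX : HasAlmostMinimalPaths X) : ProperSpace X := by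
  refine ⟨fun o => ?_⟩
  by_contra! hcon
  obtain ⟨r₀, hr₀⟩ := hcon
  let A : Set ℝ := {r | 0 ≤ r ∧ IsCompact (Metric.closedBall o r)}
  have hA0 : (0 : ℝ) ∈ A := ⟨le_rfl, by simp⟩
  have hmono : ∀ r s, IsCompact (Metric.closedBall o r) → s ≤ r → IsCompact (Metric.closedBall o s) :=
    fun r s h hs => h.of_isClosed_subset Metric.isClosed_closedBall (Metric.closedBall_subset_closedBall hs)
  have hbdd : BddAbove A := ⟨r₀, fun r hr => by
    by_contra! h
    exact hr₀ (hmono r r₀ hr.2 h.le)⟩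
  set R := sSup A with hR
  have hR0 : 0 ≤ R := le_csSup hbdd hA0
  have hlt : ∀ r < R, IsCompact (Metric.closedBall o r) := by
    intro r hr
    obtain ⟨s, hs, hrs⟩ := exists_lt_of_lt_csSup ⟨0, hA0⟩ hr
    exact hmono s r hs.2 hrs.le
  -- Every point of the ball of radius R is within δ ≤ ε/2 of the compact ball of radius R - δ/2, so
  -- an ε/2-net of the latter is an ε-net. The bound δ ≤ R keeps that radius nonnegative.
  have hcpt : IsCompact (Metric.closedBall o R) := by
    rcases hR0.eq_or_lt with h0 | h0
    · rw [← h0]; simp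
    refine isCompact_iff_totallyBounded_isComplete.2 ⟨?_, Metric.isClosed_closedBall.isComplete⟩
    rw [Metric.totallyBounded_iff]
    intro ε hε
    set δ := min (ε / 2) R with hδ
    have hδ0 : 0 < δ := lt_min (by linarith) h0
    obtain ⟨t, ht, htc⟩ := Metric.totallyBounded_iff.1
      (hlt (R - δ / 2) (by linarith)).totallyBounded (ε / 2) (by linarith)
    refine ⟨t, ht, fun y hy => ?_⟩
    obtain ⟨m, hm1, hm2⟩ := hX.exists_near (x := o) (y := y) (r := R - δ / 2) (ε := δ)
      (by linarith [min_le_right (ε / 2) R]) hδ0 (by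
        rw [dist_comm]; have := Metric.mem_closedBall.1 hy; linarith)
    have hm : m ∈ Metric.closedBall o (R - δ / 2) := by
      rw [Metric.mem_closedBall, dist_comm]; exact hm1
    obtain ⟨z, hz, hmz⟩ := mem_iUnion₂.1 (htc hm)
    refine mem_iUnion₂.2 ⟨z, hz, ?_⟩
    rw [Metric.mem_ball] at hmz ⊢
    have := dist_triangle y m z
    rw [dist_comm y m] at this
    linarith [min_le_left (ε / 2) R]
  -- A compact neighbourhood of the ball contains a thickening of it, hence a slightly larger ball,
  -- against the choice of R as supremum.
  obtain ⟨L, hL, hRL⟩ := exists_compact_superset hcpt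
  obtain ⟨δ, hδ, hthick⟩ := hcpt.exists_thickening_subset_open isOpen_interior hRL
  have hmem : R + δ / 2 ∈ A := by
    refine ⟨by linarith, hL.of_isClosed_subset Metric.isClosed_closedBall ?_⟩
    intro y hy
    obtain ⟨m, hm1, hm2⟩ := hX.exists_near (x := o) (y := y) (r := R) (ε := δ) hR0 hδ (by
      rw [dist_comm]; have := Metric.mem_closedBall.1 hy; linarith)
    refine interior_subset (hthick (Metric.mem_thickening_iff.2 ⟨m, ?_, ?_⟩))
    · rwa [Metric.mem_closedBall, dist_comm]
    · rwa [dist_comm]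
  linarith [le_csSup hbdd hmem]

/-- In a proper length space any two points are joined by a geodesic. -/
theorem HasAlmostMinimalPaths.exists_geodesic [ProperSpace X] (hX : HasAlmostMinimalPaths X)
    (x y : X) : ∃ σ : ℝ → X, σ 0 = x ∧ σ (dist x y) = y ∧
      ∀ s ∈ Icc 0 (dist x y), ∀ t ∈ Icc 0 (dist x y), dist (σ t) (σ s) = |t - s| := by
  set D := dist x y with hD
  choose l γ hl hlD h0 h1 hγ using fun n : ℕ => hX x y (1 / ((n : ℝ) + 1)) Nat.one_div_pos_of_nat
  have hDl : ∀ n, D ≤ l n := fun n => by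
    have := hγ n 0 ⟨le_rfl, hl n⟩ (l n) ⟨hl n, le_rfl⟩
    rwa [h0, h1, zero_sub, abs_neg, abs_of_nonneg (hl n)] at this
  -- Pointwise limits along a free ultrafilter take the place of Arzelà-Ascoli.
  let U : Ultrafilter ℕ := hyperfilter ℕ
  have hU : (U : Filter ℕ) ≤ atTop := Nat.hyperfilter_le_atTop
  have hlim : ∀ t ∈ Icc 0 D, ∃ z, Tendsto (fun n => γ n t) U (𝓝 z) := by
    intro t ht
    obtain ⟨z, -, hz⟩ := (isCompact_closedBall x D).ultrafilter_le_nhds (U.map fun n => γ n t) (by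
      rw [le_principal_iff]
      refine mem_map.2 (univ_mem' fun n => ?_)
      have := hγ n t ⟨ht.1, ht.2.trans (hDl n)⟩ 0 ⟨le_rfl, hl n⟩
      rw [h0, sub_zero, abs_of_nonneg ht.1] at this
      exact this.trans ht.2)
    exact ⟨z, hz⟩
  have : Nonempty X := ⟨x⟩
  choose! σ hσ using hlim
  have hmem : ∀ n t, t ∈ Icc 0 D → t ∈ Icc 0 (l n) := fun n t ht => ⟨ht.1, ht.2.trans (hDl n)⟩
  have hD0 : 0 ≤ D := dist_nonneg
  have hle : ∀ s ∈ Icc 0 D, ∀ t ∈ Icc 0 D, dist (σ s) (σ t) ≤ |s - t| := fun s hs t ht =>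
    le_of_tendsto ((hσ s hs).dist (hσ t ht)) (univ_mem' fun n => hγ n s (hmem n s hs) t (hmem n t ht))
  have hσ0 : σ 0 = x := by
    refine tendsto_nhds_unique (hσ 0 ⟨le_rfl, hD0⟩) ?_
    simp only [h0]
    exact tendsto_const_nhds
  have hσD : σ D = y := by
    refine tendsto_nhds_unique (hσ D ⟨hD0, le_rfl⟩) ?_
    rw [tendsto_iff_dist_tendsto_zero]
    refine squeeze_zero (g := fun n : ℕ => 1 / ((n : ℝ) + 1)) (fun n => dist_nonneg) (fun n => ?_)
      ((tendsto_one_div_add_atTop_nhds_zero_nat (𝕜 := ℝ)).mono_left hU)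
    have := hγ n D (hmem n D ⟨hD0, le_rfl⟩) (l n) ⟨hl n, le_rfl⟩
    rw [h1, abs_of_nonpos (by linarith [hDl n])] at this
    linarith [hlD n]
  refine ⟨σ, hσ0, hσD, ?_⟩
  -- The Lipschitz bounds on [0, s], [s, t] and [t, D] add up to exactly dist x y, so none of them
  -- can be strict.
  have key : ∀ s ∈ Icc 0 D, ∀ t ∈ Icc 0 D, s ≤ t → dist (σ s) (σ t) = t - s := by
    intro s hs t ht hst
    have a1 := hle 0 ⟨le_rfl, hD0⟩ s hs
    have a2 := hle s hs t ht
    have a3 := hle t ht D ⟨hD0, le_rfl⟩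
    rw [abs_of_nonpos (by linarith [hs.1])] at a1
    rw [abs_of_nonpos (by linarith)] at a2
    rw [abs_of_nonpos (by linarith [ht.2])] at a3
    rw [hσ0] at a1
    rw [hσD] at a3
    have := dist_triangle4 x (σ s) (σ t) y
    linarith
  intro s hs t ht
  rcases le_total s t with h | h
  · rw [dist_comm, key s hs t ht h, abs_of_nonneg (by linarith)]
  · rw [key t ht s hs h, abs_of_nonpos (by linarith)]; ring

/-- Existence of geodesics for a complete length distance `d` that induces a given locally compact
topology. -/
theorem exists_geodesic_of_dist {X : Type*} [TopologicalSpace X] [LocallyCompactSpace X]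
    (d : X → X → ℝ) (d_self : ∀ x, d x x = 0) (d_comm : ∀ x y, d x y = d y x)
    (d_triangle : ∀ x y z, d x z ≤ d x y + d y z) (eq_of_d : ∀ x y, d x y = 0 → x = y)
    (hopen : ∀ s : Set X, IsOpen s ↔ ∀ x ∈ s, ∃ ε > 0, ∀ y, d x y < ε → y ∈ s)
    (hcomplete : ∀ u : ℕ → X, (∀ ε > 0, ∃ N, ∀ m ≥ N, ∀ n ≥ N, d (u m) (u n) < ε) →
      ∃ x, Tendsto (fun n => d (u n) x) atTop (𝓝 0))
    (hpath : ∀ (x y : X) (ε : ℝ), 0 < ε → ∃ (l : ℝ) (γ : ℝ → X), 0 ≤ l ∧ l < d x y + ε ∧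
      γ 0 = x ∧ γ l = y ∧ ∀ s ∈ Icc 0 l, ∀ t ∈ Icc 0 l, d (γ s) (γ t) ≤ |s - t|) (x y : X) :
    ∃ σ : ℝ → X, σ 0 = x ∧ σ (d x y) = y ∧
      ∀ s ∈ Icc 0 (d x y), ∀ t ∈ Icc 0 (d x y), d (σ t) (σ s) = |t - s| := by
  -- The metric is built on the given topology, so local compactness carries over.
  let _ : MetricSpace X :=
    MetricSpace.ofDistTopology d d_self d_comm d_triangle hopen eq_of_d
  have : CompleteSpace X := Metric.complete_of_cauchySeq_tendsto fun u hu => by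
    obtain ⟨x, hx⟩ := hcomplete u (Metric.cauchySeq_iff.1 hu)
    exact ⟨x, tendsto_iff_dist_tendsto_zero.2 hx⟩
  have hX : HasAlmostMinimalPaths X := hpath
  have := hX.properSpace
  exact hX.exists_geodesic x y

end LengthSpace

/-! ### Diameters and automorphisms of the Poincaré disc. -/

section Hyperbolic

theorem Real.tanh_sub_eq (s t : ℝ) :
    Real.tanh (s - t) = (Real.tanh s - Real.tanh t) / (1 - Real.tanh s * Real.tanh t) := by
  have hs := (Real.cosh_pos s).ne'
  have ht := (Real.cosh_pos t).ne'
  have hst := (Real.cosh_pos (s - t)).ne'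
  simp only [Real.tanh_eq_sinh_div_cosh]
  have h : 1 - Real.sinh s / Real.cosh s * (Real.sinh t / Real.cosh t) =
      Real.cosh (s - t) / (Real.cosh s * Real.cosh t) := by
    rw [Real.cosh_sub]
    field_simp
  rw [h, Real.sinh_sub]
  field_simp

theorem Real.abs_tanh (t : ℝ) : |Real.tanh t| = Real.tanh |t| := by
  have hpos : ∀ x : ℝ, 0 ≤ x → 0 ≤ Real.tanh x := fun x hx => by
    rw [Real.tanh_eq_sinh_div_cosh]
    exact div_nonneg (Real.sinh_nonneg_iff.2 hx) (Real.cosh_pos x).le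
  rcases abs_cases t with ⟨h, h'⟩ | ⟨h, h'⟩
  · rw [h, abs_of_nonneg (hpos t h')]
  · rw [h, Real.tanh_neg, abs_of_nonpos]
    have := hpos (-t) (by linarith)
    rw [Real.tanh_neg] at this
    linarith

theorem Real.hasDerivAt_tanh (t : ℝ) : HasDerivAt Real.tanh (1 - Real.tanh t ^ 2) t := by
  have h := (Real.hasDerivAt_sinh t).div (Real.hasDerivAt_cosh t) (Real.cosh_pos t).ne'
  have hfun : Real.tanh = Real.sinh / Real.cosh := by
    ext x
    simp [Real.tanh_eq_sinh_div_cosh]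
  have h' : HasDerivAt Real.tanh _ t := hfun ▸ h
  refine h'.congr_deriv ?_
  have := (Real.cosh_pos t).ne'
  rw [Real.tanh_eq_sinh_div_cosh]
  field_simp

theorem Real.contDiff_tanh {n : WithTop ℕ∞} : ContDiff ℝ n Real.tanh := by
  have hfun : Real.tanh = fun x => Real.sinh x / Real.cosh x := by
    ext x
    rw [Real.tanh_eq_sinh_div_cosh]
  rw [hfun]
  exact Real.contDiff_sinh.div Real.contDiff_cosh fun x => (Real.cosh_pos x).ne'

theorem poincareDist_nonneg (a b : ℂ) : 0 ≤ poincareDist a b :=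
  Real.artanh_nonneg (norm_nonneg _)

theorem poincareDist_comm (a b : ℂ) : poincareDist a b = poincareDist b a := by
  unfold poincareDist
  congr 1
  rw [norm_div, norm_div, norm_sub_rev a b]
  congr 1
  rw [← RCLike.norm_conj (1 - _)]
  simp [mul_comm]

/-- The subtraction formula turns the Möbius quotient into u tanh (s - t). Diameters parametrized in
this way are the pieces of all paths built from discs. -/
theorem poincareDist_tanh {u : ℂ} (hu : ‖u‖ = 1) (s t : ℝ) :
    poincareDist (u * Real.tanh s) (u * Real.tanh t) = |s - t| := by
  unfold poincareDist
  have huu : (starRingEnd ℂ) u * u = 1 := by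
    rw [← Complex.normSq_eq_conj_mul_self, Complex.normSq_eq_norm_sq, hu]
    simp
  have h : (u * Real.tanh s - u * Real.tanh t) /
      (1 - (starRingEnd ℂ) (u * Real.tanh s) * (u * Real.tanh t)) =
      u * ((Real.tanh (s - t) : ℝ) : ℂ) := by
    rw [Real.tanh_sub_eq, map_mul, Complex.conj_ofReal]
    have : (starRingEnd ℂ) u * (Real.tanh s : ℂ) * (u * (Real.tanh t : ℂ)) =
        Real.tanh s * Real.tanh t := by
      linear_combination (Real.tanh s * Real.tanh t : ℂ) * huu
    rw [this]
    push_cast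
    ring
  rw [h, norm_mul, hu, one_mul, Complex.norm_real, Real.norm_eq_abs, Real.abs_tanh,
    Real.artanh_tanh]

/-- The automorphism of the unit disc that maps `0` to `a`. -/
noncomputable def discAut (a ζ : ℂ) : ℂ := (ζ + a) / (1 + (starRingEnd ℂ) a * ζ)

theorem one_add_conj_mul_ne_zero {a ζ : ℂ} (ha : ‖a‖ < 1) (hζ : ‖ζ‖ < 1) :
    1 + (starRingEnd ℂ) a * ζ ≠ 0 := by
  intro h
  have h1 : ‖(starRingEnd ℂ) a * ζ‖ = 1 := by
    rw [eq_neg_of_add_eq_zero_right h]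
    simp
  rw [norm_mul, RCLike.norm_conj] at h1
  nlinarith [norm_nonneg a, norm_nonneg ζ]

theorem norm_discAut_lt_one {a ζ : ℂ} (ha : ‖a‖ < 1) (hζ : ‖ζ‖ < 1) : ‖discAut a ζ‖ < 1 := by
  have hne := one_add_conj_mul_ne_zero ha hζ
  rw [discAut, norm_div, div_lt_one (norm_pos_iff.2 hne)]
  refine lt_of_pow_lt_pow_left₀ 2 (norm_nonneg _) ?_
  have h1 : ‖a‖ ^ 2 < 1 := by nlinarith [norm_nonneg a]
  have h2 : ‖ζ‖ ^ 2 < 1 := by nlinarith [norm_nonneg ζ]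
  rw [← Complex.normSq_eq_norm_sq, Complex.normSq_apply] at h1 h2 ⊢
  rw [← Complex.normSq_eq_norm_sq, Complex.normSq_apply]
  simp
  -- Uses |1 + āζ|² - |ζ + a|² = (1 - |a|²)(1 - |ζ|²).
  nlinarith [mul_pos (sub_pos.2 h1) (sub_pos.2 h2)]

theorem hasDerivAt_discAut_zero (a : ℂ) :
    HasDerivAt (discAut a) (1 - (starRingEnd ℂ) a * a) 0 := by
  have h1 : HasDerivAt (fun ζ : ℂ => ζ + a) 1 0 := (hasDerivAt_id (0 : ℂ)).add_const a
  have h2 : HasDerivAt (fun ζ : ℂ => 1 + (starRingEnd ℂ) a * ζ) ((starRingEnd ℂ) a) 0 := by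
    simpa using ((hasDerivAt_id (0 : ℂ)).const_mul ((starRingEnd ℂ) a)).const_add 1
  exact (h1.div h2 (by simp)).congr_deriv (by simp [mul_comm])

theorem differentiableOn_discAut {a : ℂ} (ha : ‖a‖ < 1) :
    DifferentiableOn ℂ (discAut a) (Metric.ball 0 1) := by
  intro ζ hζ
  unfold discAut
  refine DifferentiableAt.differentiableWithinAt ?_
  exact DifferentiableAt.div (by fun_prop) (by fun_prop)
    (one_add_conj_mul_ne_zero ha (mem_ball_zero_iff.1 hζ))

@[simp]
theorem discAut_zero (a : ℂ) : discAut a 0 = a := by simp [discAut]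

variable {d : ℕ} {Ω : Set (CSpace d)}

theorem IsHolDisc.comp_discAut {φ : ℂ → CSpace d} (hφ : IsHolDisc Ω φ) {a : ℂ} (ha : ‖a‖ < 1) :
    IsHolDisc Ω (φ ∘ discAut a) := by
  have hm : MapsTo (discAut a) (Metric.ball 0 1) (Metric.ball 0 1) := fun ζ hζ =>
    mem_ball_zero_iff.2 (norm_discAut_lt_one ha (mem_ball_zero_iff.1 hζ))
  exact ⟨hφ.1.comp (differentiableOn_discAut ha) hm, hφ.2.comp hm⟩

theorem IsHolDisc.differentiableAt {φ : ℂ → CSpace d} (hφ : IsHolDisc Ω φ) {a : ℂ} (ha : ‖a‖ < 1) :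
    DifferentiableAt ℂ φ a :=
  hφ.1.differentiableAt (Metric.isOpen_ball.mem_nhds (mem_ball_zero_iff.2 ha))

/-- Every two points of a holomorphic disc lie on a diameter of a suitable reparametrization. -/
theorem IsHolDisc.exists_normalized {φ : ℂ → CSpace d} (hφ : IsHolDisc Ω φ) {a b : ℂ}
    (ha : ‖a‖ < 1) (hb : ‖b‖ < 1) : ∃ (ψ : ℂ → CSpace d) (u : ℂ), IsHolDisc Ω ψ ∧ ‖u‖ = 1 ∧
      ψ 0 = φ a ∧ ψ (u * Real.tanh (poincareDist a b)) = φ b := by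
  have hb' : ‖-b‖ < 1 := by rwa [norm_neg]
  have hne : 1 - (starRingEnd ℂ) a * b ≠ 0 := by
    have := one_add_conj_mul_ne_zero ha hb'
    rwa [mul_neg, ← sub_eq_add_neg] at this
  have ha' : ‖-a‖ < 1 := by rwa [norm_neg]
  -- The image of b under the automorphism that sends a to 0.
  set c := (b - a) / (1 - (starRingEnd ℂ) a * b) with hc
  have hc1 : ‖c‖ < 1 := by
    have := norm_discAut_lt_one ha' hb
    rwa [discAut, map_neg, neg_mul, ← sub_eq_add_neg, ← sub_eq_add_neg] at this
  have hp : Real.tanh (poincareDist a b) = ‖c‖ := by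
    rw [poincareDist, Real.tanh_artanh]
    · rw [hc, norm_div, norm_div, norm_sub_rev]
    · have : ‖(a - b) / (1 - (starRingEnd ℂ) a * b)‖ = ‖c‖ := by
        rw [hc, norm_div, norm_div, norm_sub_rev]
      rw [this]
      exact ⟨by linarith [norm_nonneg c], hc1⟩
  have hcb : discAut a c = b := by
    have hna : 1 + (starRingEnd ℂ) a * c ≠ 0 := one_add_conj_mul_ne_zero ha hc1
    have hc' : c * (1 - (starRingEnd ℂ) a * b) = b - a := div_mul_cancel₀ _ hne
    rw [discAut, div_eq_iff hna]
    linear_combination hc'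
  obtain ⟨u, hu, huc⟩ : ∃ u : ℂ, ‖u‖ = 1 ∧ u * ‖c‖ = c := by
    by_cases h : c = 0
    · exact ⟨1, by simp, by simp [h]⟩
    · have hn : (‖c‖ : ℂ) ≠ 0 := by exact_mod_cast norm_ne_zero_iff.2 h
      exact ⟨c / ‖c‖, by simp [h], div_mul_cancel₀ _ hn⟩
  exact ⟨φ ∘ discAut a, u, hφ.comp_discAut ha, hu, by simp, by simp [hp, huc, hcb]⟩

theorem kobMetric_le {z v : CSpace d} {φ : ℂ → CSpace d} {α : ℂ} (hφ : IsHolDisc Ω φ)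
    (h0 : φ 0 = z) (h1 : α • deriv φ 0 = v) : kobMetric Ω z v ≤ ‖α‖ := by
  refine csInf_le ⟨0, ?_⟩ ⟨φ, α, hφ, h0, h1, rfl⟩
  rintro r ⟨φ, α, -, -, -, rfl⟩
  exact norm_nonneg α

theorem norm_mul_tanh_lt_one {u : ℂ} (hu : ‖u‖ = 1) (t : ℝ) : ‖u * (Real.tanh t : ℂ)‖ < 1 := by
  rw [norm_mul, hu, one_mul, Complex.norm_real]
  exact Real.abs_tanh_lt_one t

/-- With a = u tanh t, the disc φ ∘ `discAut a` has derivative (1 - |a|²) φ'(a) at 0, and tanh' = 1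
- tanh² is the same factor. The scalar α is therefore u itself, of modulus 1. -/
theorem IsHolDisc.kobMetric_deriv_le {φ : ℂ → CSpace d} (hφ : IsHolDisc Ω φ) {u : ℂ} (hu : ‖u‖ = 1)
    (t : ℝ) : kobMetric Ω (φ (u * Real.tanh t)) (deriv (fun s : ℝ => φ (u * Real.tanh s)) t) ≤ 1 := by
  have hlt := norm_mul_tanh_lt_one hu t
  have hd := (hφ.differentiableAt hlt).hasDerivAt
  have huu : (starRingEnd ℂ) u * u = 1 := by
    rw [← Complex.normSq_eq_conj_mul_self, Complex.normSq_eq_norm_sq, hu]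
    simp
  have h1 : HasDerivAt (fun s : ℝ => u * (Real.tanh s : ℂ)) (u * ((1 - Real.tanh t ^ 2 : ℝ) : ℂ)) t :=
    (Real.hasDerivAt_tanh t).ofReal_comp.const_mul u
  have h2 : HasDerivAt (fun s : ℝ => φ (u * Real.tanh s)) _ t := hd.scomp t h1
  have h3 : HasDerivAt (φ ∘ discAut (u * Real.tanh t)) _ 0 :=
    HasDerivAt.scomp_of_eq (0 : ℂ) hd (hasDerivAt_discAut_zero (u * Real.tanh t)) (by simp)
  rw [← hu]
  refine kobMetric_le (hφ.comp_discAut hlt) (by simp) ?_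
  rw [h2.deriv, h3.deriv, smul_smul]
  congr 1
  rw [map_mul, Complex.conj_ofReal]
  rw [Complex.ofReal_sub, Complex.ofReal_one, Complex.ofReal_pow]
  linear_combination (-u * (Real.tanh t : ℂ) ^ 2) * huu

theorem IsHolDisc.contDiff_comp_tanh {φ : ℂ → CSpace d} (hφ : IsHolDisc Ω φ) {u : ℂ} (hu : ‖u‖ = 1) :
    ContDiff ℝ 1 (fun s : ℝ => φ (u * Real.tanh s)) := by
  have h1 : ContDiffOn ℝ 1 φ (Metric.ball 0 1) :=
    (hφ.1.contDiffOn Metric.isOpen_ball).restrict_scalars ℝ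
  have h2 : ContDiff ℝ 1 (fun s : ℝ => u * (Real.tanh s : ℂ)) :=
    contDiff_const.mul (Complex.ofRealCLM.contDiff.comp Real.contDiff_tanh)
  exact h1.comp_contDiff h2 fun s => mem_ball_zero_iff.2 (norm_mul_tanh_lt_one hu s)

end Hyperbolic

/-! ### The Kobayashi distance as a length distance; Barth's theorem. -/

section KobayashiDistance

open scoped NNReal

variable {d : ℕ} {Ω : Set (CSpace d)}

/-- Chains of holomorphic discs, built by prepending one disc at a time. -/
inductive DiscChain (Ω : Set (CSpace d)) : CSpace d → CSpace d → ℝ → Prop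
  | nil (z : CSpace d) : DiscChain Ω z z 0
  | cons {φ : ℂ → CSpace d} {a b : ℂ} {w : CSpace d} {L : ℝ} (hφ : IsHolDisc Ω φ)
      (ha : a ∈ Metric.ball (0 : ℂ) 1) (hb : b ∈ Metric.ball (0 : ℂ) 1)
      (h : DiscChain Ω (φ b) w L) : DiscChain Ω (φ a) w (poincareDist a b + L)

theorem DiscChain.isChainLength {z w : CSpace d} {L : ℝ} (h : DiscChain Ω z w L) :
    IsChainLength Ω z w L := by
  induction h with
  | nil z => exact ⟨0, fun _ => z, fun _ _ => z, 0, 0, rfl, rfl, by simp, by simp⟩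
  | @cons φ a b w L hφ ha hb h ih =>
    obtain ⟨n, x, ψ, a', b', h0, hn, hi, hL⟩ := ih
    refine ⟨n + 1, fun i => Nat.casesOn i (φ a) x, fun i => Nat.casesOn i φ ψ,
      fun i => Nat.casesOn i a a', fun i => Nat.casesOn i b b', rfl, hn, ?_, ?_⟩
    · intro i hin
      cases i with
      | zero => exact ⟨hφ, ha, hb, rfl, h0.symm⟩
      | succ i => exact hi i (by omega)
    · rw [Finset.sum_range_succ', hL, add_comm]
      rfl

theorem IsChainLength.discChain {z w : CSpace d} {L : ℝ} (h : IsChainLength Ω z w L) :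
    DiscChain Ω z w L := by
  obtain ⟨n, x, φ, a, b, h0, hn, hi, rfl⟩ := h
  induction n generalizing x φ a b z with
  | zero =>
    subst h0 hn
    simpa using DiscChain.nil (x 0)
  | succ n ih =>
    obtain ⟨hφ, ha, hb, h1, h2⟩ := hi 0 (by omega)
    have := ih (z := x 1) (fun i => x (i + 1)) (fun i => φ (i + 1)) (fun i => a (i + 1))
      (fun i => b (i + 1)) rfl hn fun i hin => hi (i + 1) (by omega)
    rw [Finset.sum_range_succ', add_comm, ← h0, ← h1]
    exact DiscChain.cons hφ ha hb (by rwa [h2])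

theorem isChainLength_iff_discChain {z w : CSpace d} {L : ℝ} :
    IsChainLength Ω z w L ↔ DiscChain Ω z w L :=
  ⟨IsChainLength.discChain, DiscChain.isChainLength⟩

theorem DiscChain.trans {x y z : CSpace d} {L M : ℝ} (h : DiscChain Ω x y L)
    (h' : DiscChain Ω y z M) : DiscChain Ω x z (L + M) := by
  induction h with
  | nil z => simpa using h'
  | cons hφ ha hb h ih =>
    rw [add_assoc]
    exact DiscChain.cons hφ ha hb (ih h')

theorem DiscChain.single {φ : ℂ → CSpace d} {a b : ℂ} (hφ : IsHolDisc Ω φ)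
    (ha : a ∈ Metric.ball (0 : ℂ) 1) (hb : b ∈ Metric.ball (0 : ℂ) 1) :
    DiscChain Ω (φ a) (φ b) (poincareDist a b) := by
  simpa using DiscChain.cons hφ ha hb (DiscChain.nil (φ b))

theorem DiscChain.symm {x y : CSpace d} {L : ℝ} (h : DiscChain Ω x y L) : DiscChain Ω y x L := by
  induction h with
  | nil z => exact DiscChain.nil z
  | @cons φ a b w L hφ ha hb h ih =>
    rw [add_comm, poincareDist_comm]
    exact ih.trans (DiscChain.single hφ hb ha)

theorem DiscChain.nonneg {x y : CSpace d} {L : ℝ} (h : DiscChain Ω x y L) : 0 ≤ L := by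
  induction h with
  | nil z => exact le_rfl
  | cons hφ ha hb h ih => exact add_nonneg (poincareDist_nonneg _ _) ih

theorem kobDist_eq (z w : Ω) : kobDist Ω z w = sInf {L : ℝ | DiscChain Ω z w L} := by
  simp only [kobDist, isChainLength_iff_discChain]

theorem kobDist_nonneg (z w : Ω) : 0 ≤ kobDist Ω z w := by
  rw [kobDist_eq]
  exact Real.sInf_nonneg fun L hL => DiscChain.nonneg hL

theorem DiscChain.kobDist_le {z w : Ω} {L : ℝ} (h : DiscChain Ω z w L) : kobDist Ω z w ≤ L := by
  rw [kobDist_eq]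
  exact csInf_le ⟨0, fun L hL => DiscChain.nonneg hL⟩ h

theorem kobDist_self (z : Ω) : kobDist Ω z z = 0 :=
  le_antisymm (DiscChain.nil _).kobDist_le (kobDist_nonneg z z)

theorem kobDist_comm (z w : Ω) : kobDist Ω z w = kobDist Ω w z := by
  rw [kobDist_eq, kobDist_eq]
  congr 1
  ext L
  exact ⟨DiscChain.symm, DiscChain.symm⟩

/-- Nearby points are joined by an affine disc. -/
theorem exists_discChain_of_ball_subset {z w : CSpace d} {r : ℝ} (hr : Metric.ball z r ⊆ Ω)
    (hw : w ∈ Metric.ball z r) : DiscChain Ω z w (Real.artanh (‖w - z‖ / r)) := by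
  rw [Metric.mem_ball, dist_eq_norm] at hw
  have hr0 : 0 < r := (norm_nonneg _).trans_lt hw
  -- For w = z the quotient r / 0 is 0 and the disc is constant.
  let φ : ℂ → CSpace d := fun ζ => z + (ζ * ((r / ‖w - z‖ : ℝ) : ℂ)) • (w - z)
  have hφ : IsHolDisc Ω φ := by
    refine ⟨?_, fun ζ hζ => hr ?_⟩
    · exact Differentiable.differentiableOn (by fun_prop)
    · rw [mem_ball_zero_iff] at hζ
      rw [mem_ball_iff_norm, add_sub_cancel_left, norm_smul, norm_mul, Complex.norm_real,
        Real.norm_eq_abs, abs_of_nonneg (by positivity)]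
      by_cases h : ‖w - z‖ = 0
      · simpa [h] using hr0
      · rw [mul_assoc, div_mul_cancel₀ _ h]
        nlinarith
  have hlt : ‖w - z‖ / r < 1 := (div_lt_one hr0).2 hw
  have hb : ((‖w - z‖ / r : ℝ) : ℂ) ∈ Metric.ball (0 : ℂ) 1 := by
    rw [mem_ball_zero_iff, Complex.norm_real, Real.norm_eq_abs, abs_of_nonneg (by positivity)]
    exact hlt
  have h := DiscChain.single hφ (Metric.mem_ball_self one_pos) hb
  have h0 : φ 0 = z := by simp [φ]
  have h1 : φ ((‖w - z‖ / r : ℝ) : ℂ) = w := by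
    by_cases h : ‖w - z‖ = 0
    · have : w = z := by rwa [norm_eq_zero, sub_eq_zero] at h
      simp [φ, this]
    · have : ‖w - z‖ / r * (r / ‖w - z‖) = 1 := by field_simp
      simp only [φ]
      rw [← Complex.ofReal_mul, this]
      simp
  have h2 : poincareDist 0 ((‖w - z‖ / r : ℝ) : ℂ) = Real.artanh (‖w - z‖ / r) := by
    rw [poincareDist]
    congr 1
    rw [zero_sub, map_zero, zero_mul, sub_zero, div_one, norm_neg, Complex.norm_real,
      Real.norm_eq_abs, abs_of_nonneg (by positivity)]
  rwa [h0, h1, h2] at h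

/-- The points reachable from z form a clopen set. This keeps the infimum in `kobDist` from being
the default value `sInf ∅ = 0`, for which the triangle inequality could fail. -/
theorem exists_discChain (hΩ : IsOpen Ω) (hc : IsConnected Ω) (z w : Ω) :
    ∃ L, DiscChain Ω z w L := by
  have : ConnectedSpace Ω := isConnected_iff_connectedSpace.1 hc
  have hloc : ∀ x : Ω, ∀ᶠ y : Ω in 𝓝 x, ∃ L, DiscChain Ω x y L := by
    intro x
    obtain ⟨r, hr, hb⟩ := Metric.isOpen_iff.1 hΩ x x.2
    filter_upwards [continuous_subtype_val.continuousAt.preimage_mem_nhds (Metric.ball_mem_nhds _ hr)]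
      with y hy
    exact ⟨_, exists_discChain_of_ball_subset hb hy⟩
  let S : Set Ω := {y | ∃ L, DiscChain Ω z y L}
  have hS : IsClopen S := by
    constructor
    · rw [← isOpen_compl_iff, isOpen_iff_mem_nhds]
      intro y hy
      filter_upwards [hloc y] with y' ⟨L, hL⟩ ⟨L', hL'⟩
      exact hy ⟨_, hL'.trans hL.symm⟩
    · rw [isOpen_iff_mem_nhds]
      rintro y ⟨L, hL⟩
      filter_upwards [hloc y] with y' ⟨L', hL'⟩
      exact ⟨_, hL.trans hL'⟩
  have : S = univ := hS.eq_univ ⟨z, 0, DiscChain.nil _⟩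
  exact (this ▸ mem_univ w : w ∈ S)

theorem exists_discChain_lt (hΩ : IsOpen Ω) (hc : IsConnected Ω) (z w : Ω) {ε : ℝ} (hε : 0 < ε) :
    ∃ L < kobDist Ω z w + ε, DiscChain Ω z w L := by
  have hne : {L : ℝ | DiscChain Ω z w L}.Nonempty := exists_discChain hΩ hc z w
  obtain ⟨L, hL, hlt⟩ := exists_lt_of_csInf_lt hne (lt_add_of_pos_right _ hε)
  exact ⟨L, by rwa [kobDist_eq], hL⟩

theorem kobDist_triangle (hΩ : IsOpen Ω) (hc : IsConnected Ω) (x y z : Ω) :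
    kobDist Ω x z ≤ kobDist Ω x y + kobDist Ω y z := by
  refine le_of_forall_pos_le_add fun ε hε => ?_
  obtain ⟨L, hL, h⟩ := exists_discChain_lt hΩ hc x y (half_pos hε)
  obtain ⟨M, hM, h'⟩ := exists_discChain_lt hΩ hc y z (half_pos hε)
  linarith [(h.trans h').kobDist_le]

theorem eventually_kobDist_lt (hΩ : IsOpen Ω) (x : Ω) {ε : ℝ} (hε : 0 < ε) :
    ∀ᶠ y in 𝓝 x, kobDist Ω x y < ε := by
  obtain ⟨r, hr, hb⟩ := Metric.isOpen_iff.1 hΩ x x.2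
  have htanh : 0 < Real.tanh ε := by
    rw [Real.tanh_eq_sinh_div_cosh]
    exact div_pos (Real.sinh_pos_iff.2 hε) (Real.cosh_pos ε)
  filter_upwards [continuous_subtype_val.continuousAt.preimage_mem_nhds
    (Metric.ball_mem_nhds (x : CSpace d) (mul_pos hr htanh))] with y hy
  have hy' : ‖(y : CSpace d) - x‖ < r * Real.tanh ε := by
    rwa [mem_preimage, mem_ball_iff_norm] at hy
  have h1 := Real.tanh_lt_one ε
  refine (exists_discChain_of_ball_subset hb (w := y) ?_).kobDist_le.trans_lt ?_
  · rw [mem_ball_iff_norm]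
    nlinarith
  · have h2 : ‖(y : CSpace d) - x‖ / r < Real.tanh ε := by
      rw [div_lt_iff₀ hr]
      linarith
    have h3 : (0 : ℝ) ≤ ‖(y : CSpace d) - x‖ / r := by positivity
    calc _ < Real.artanh (Real.tanh ε) := Real.artanh_lt_artanh (by linarith) h1 h2
      _ = ε := Real.artanh_tanh ε

theorem continuous_kobDist (hΩ : IsOpen Ω) (hc : IsConnected Ω) (o : Ω) :
    Continuous (kobDist Ω o) := by
  rw [continuous_iff_continuousAt]
  intro x
  refine Metric.tendsto_nhds.2 fun ε hε => ?_
  filter_upwards [eventually_kobDist_lt hΩ x hε] with y hy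
  rw [Real.dist_eq, abs_lt]
  have h1 := kobDist_triangle hΩ hc o x y
  have h2 := kobDist_triangle hΩ hc o y x
  rw [kobDist_comm y x] at h2
  constructor <;> linarith

/-- `γ` is a Lipschitz path of length at most `l` from `x` to `y`, parametrized on `[0, l]`, whose
speed with respect to the Kobayashi metric is at most one. -/
structure IsUnitSpeedPath (Ω : Set (CSpace d)) (l : ℝ) (γ : ℝ → Ω) (x y : Ω) : Prop where
  nonneg : 0 ≤ l
  source : γ 0 = x
  target : γ l = y
  lipschitz : ∃ C : ℝ≥0, LipschitzOnWith C (fun t => (γ t : CSpace d)) (Icc 0 l)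
  kobMetric_le : ∀ᵐ t ∂(volume.restrict (Icc 0 l)),
    kobMetric Ω (γ t) (deriv (fun s => (γ s : CSpace d)) t) ≤ 1
  kobDist_le : ∀ s ∈ Icc 0 l, ∀ t ∈ Icc 0 l, kobDist Ω (γ s) (γ t) ≤ |s - t|

theorem IsUnitSpeedPath.refl (x : Ω) : IsUnitSpeedPath Ω 0 (fun _ => x) x x where
  nonneg := le_rfl
  source := rfl
  target := rfl
  lipschitz := ⟨0, LipschitzWith.lipschitzOnWith (LipschitzWith.const _)⟩
  kobMetric_le := by simp
  kobDist_le := by simp [kobDist_self]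

theorem IsHolDisc.exists_unitSpeedPath {φ : ℂ → CSpace d} (hφ : IsHolDisc Ω φ) {a b : ℂ} {x y : Ω}
    (ha : a ∈ Metric.ball (0 : ℂ) 1) (hb : b ∈ Metric.ball (0 : ℂ) 1) (hx : φ a = x) (hy : φ b = y) :
    ∃ γ, IsUnitSpeedPath Ω (poincareDist a b) γ x y := by
  obtain ⟨ψ, u, hψ, hu, h0, h1⟩ :=
    hφ.exists_normalized (mem_ball_zero_iff.1 ha) (mem_ball_zero_iff.1 hb)
  have hmem : ∀ t : ℝ, u * (Real.tanh t : ℂ) ∈ Metric.ball (0 : ℂ) 1 := fun t =>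
    mem_ball_zero_iff.2 (norm_mul_tanh_lt_one hu t)
  refine ⟨fun t => ⟨ψ (u * Real.tanh t), hψ.2 (hmem t)⟩, poincareDist_nonneg a b, ?_, ?_, ?_, ?_, ?_⟩
  · apply Subtype.ext
    simpa [hx] using h0
  · apply Subtype.ext
    simp only [h1, hy]
  · exact (hψ.contDiff_comp_tanh hu).contDiffOn.exists_lipschitzOnWith one_ne_zero (convex_Icc _ _)
      isCompact_Icc
  · exact Eventually.of_forall fun t => hψ.kobMetric_deriv_le hu t
  · intro s _ t _
    rw [← poincareDist_tanh hu s t]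
    exact DiscChain.kobDist_le (DiscChain.single hψ (hmem s) (hmem t))

theorem IsUnitSpeedPath.trans (hΩ : IsOpen Ω) (hc : IsConnected Ω) {l₁ l₂ : ℝ} {γ₁ γ₂ : ℝ → Ω}
    {x y z : Ω} (h₁ : IsUnitSpeedPath Ω l₁ γ₁ x y) (h₂ : IsUnitSpeedPath Ω l₂ γ₂ y z) :
    IsUnitSpeedPath Ω (l₁ + l₂) (fun t => if t ≤ l₁ then γ₁ t else γ₂ (t - l₁)) x z := by
  have hl₁ := h₁.nonneg
  have hl₂ := h₂.nonneg
  set γ : ℝ → Ω := fun t => if t ≤ l₁ then γ₁ t else γ₂ (t - l₁) with hγ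
  have hγ1 : ∀ t ≤ l₁, γ t = γ₁ t := fun t ht => if_pos ht
  have hγ2 : ∀ t, l₁ ≤ t → γ t = γ₂ (t - l₁) := fun t ht => by
    rcases ht.eq_or_lt with rfl | h
    · rw [hγ1 _ le_rfl, h₁.target, sub_self, h₂.source]
    · exact if_neg h.not_ge
  refine ⟨by linarith, ?_, ?_, ?_, ?_, ?_⟩
  · rw [hγ1 0 hl₁, h₁.source]
  · rw [hγ2 _ (by linarith), add_sub_cancel_left, h₂.target]
  · obtain ⟨C₁, hC₁⟩ := h₁.lipschitz
    obtain ⟨C₂, hC₂⟩ := h₂.lipschitz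
    refine ⟨max C₁ C₂, ?_⟩
    have hC₁' : ∀ s ∈ Icc 0 l₁, ∀ t ∈ Icc 0 l₁, dist (γ s : CSpace d) (γ t) ≤ max C₁ C₂ * |s - t| := by
      intro s hs t ht
      rw [hγ1 s hs.2, hγ1 t ht.2]
      refine (hC₁.dist_le_mul s hs t ht).trans ?_
      rw [Real.dist_eq]
      gcongr
      exact le_max_left _ _
    have hC₂' : ∀ s ∈ Icc l₁ (l₁ + l₂), ∀ t ∈ Icc l₁ (l₁ + l₂),
        dist (γ s : CSpace d) (γ t) ≤ max C₁ C₂ * |s - t| := by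
      intro s hs t ht
      rw [hγ2 s hs.1, hγ2 t ht.1]
      refine (hC₂.dist_le_mul (s - l₁) ⟨by linarith [hs.1], by linarith [hs.2]⟩ (t - l₁)
        ⟨by linarith [ht.1], by linarith [ht.2]⟩).trans ?_
      rw [Real.dist_eq, sub_sub_sub_cancel_right]
      gcongr
      exact le_max_right _ _
    have key : ∀ s ∈ Icc 0 (l₁ + l₂), ∀ t ∈ Icc 0 (l₁ + l₂), s ≤ t →
        dist (γ s : CSpace d) (γ t) ≤ max C₁ C₂ * |s - t| := by
      intro s hs t ht hst
      rcases le_total t l₁ with h | h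
      · exact hC₁' s ⟨hs.1, hst.trans h⟩ t ⟨ht.1, h⟩
      rcases le_total l₁ s with h' | h'
      · exact hC₂' s ⟨h', hs.2⟩ t ⟨h, ht.2⟩
      · have a1 := hC₁' s ⟨hs.1, h'⟩ l₁ ⟨hl₁, le_rfl⟩
        have a2 := hC₂' l₁ ⟨le_rfl, by linarith⟩ t ⟨h, ht.2⟩
        have a3 := dist_triangle (γ s : CSpace d) (γ l₁) (γ t)
        have a4 : |s - l₁| + |l₁ - t| = |s - t| := by
          rw [abs_of_nonpos (by linarith), abs_of_nonpos (by linarith), abs_of_nonpos (by linarith)]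
          ring
        rw [← a4, mul_add]
        linarith
    refine LipschitzOnWith.of_dist_le_mul fun s hs t ht => ?_
    rw [Real.dist_eq]
    rcases le_total s t with h | h
    · exact key s hs t ht h
    · rw [dist_comm, abs_sub_comm]
      exact key t ht s hs h
  · rw [ae_restrict_iff' measurableSet_Icc]
    have e₁ := (ae_restrict_iff' measurableSet_Icc).1 h₁.kobMetric_le
    have e₂ := (measurePreserving_sub_right volume l₁).quasiMeasurePreserving.ae
      ((ae_restrict_iff' measurableSet_Icc).1 h₂.kobMetric_le)
    -- The junction is a null set; away from it the path agrees locally with one of the two pieces.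
    filter_upwards [e₁, e₂, Measure.ae_ne volume l₁] with t ht₁ ht₂ hne hmem
    rcases hne.lt_or_gt with h | h
    · have hev : (fun s => (γ s : CSpace d)) =ᶠ[𝓝 t] fun s => (γ₁ s : CSpace d) := by
        filter_upwards [Iio_mem_nhds h] with s hs
        rw [hγ1 s (le_of_lt hs)]
      rw [hev.deriv_eq, hγ1 t h.le]
      exact ht₁ ⟨hmem.1, h.le⟩
    · have hev : (fun s => (γ s : CSpace d)) =ᶠ[𝓝 t] fun s => (γ₂ (s - l₁) : CSpace d) := by
        filter_upwards [Ioi_mem_nhds h] with s hs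
        rw [hγ2 s (le_of_lt hs)]
      rw [hev.deriv_eq, hγ2 t h.le, deriv_comp_sub_const (fun s => (γ₂ s : CSpace d))]
      exact ht₂ ⟨by linarith, by linarith [hmem.2]⟩
  · have key : ∀ s ∈ Icc 0 (l₁ + l₂), ∀ t ∈ Icc 0 (l₁ + l₂), s ≤ t →
        kobDist Ω (γ s) (γ t) ≤ |s - t| := by
      intro s hs t ht hst
      have hC₂' : ∀ s ∈ Icc l₁ (l₁ + l₂), ∀ t ∈ Icc l₁ (l₁ + l₂),
          kobDist Ω (γ s) (γ t) ≤ |s - t| := by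
        intro s hs t ht
        rw [hγ2 s hs.1, hγ2 t ht.1]
        refine (h₂.kobDist_le (s - l₁) ⟨by linarith [hs.1], by linarith [hs.2]⟩ (t - l₁)
          ⟨by linarith [ht.1], by linarith [ht.2]⟩).trans ?_
        rw [sub_sub_sub_cancel_right]
      have hC₁' : ∀ s ∈ Icc 0 l₁, ∀ t ∈ Icc 0 l₁, kobDist Ω (γ s) (γ t) ≤ |s - t| := by
        intro s hs t ht
        rw [hγ1 s hs.2, hγ1 t ht.2]
        exact h₁.kobDist_le s hs t ht
      rcases le_total t l₁ with h | h
      · exact hC₁' s ⟨hs.1, hst.trans h⟩ t ⟨ht.1, h⟩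
      rcases le_total l₁ s with h' | h'
      · exact hC₂' s ⟨h', hs.2⟩ t ⟨h, ht.2⟩
      · have a1 := hC₁' s ⟨hs.1, h'⟩ l₁ ⟨hl₁, le_rfl⟩
        have a2 := hC₂' l₁ ⟨le_rfl, by linarith⟩ t ⟨h, ht.2⟩
        have a3 := kobDist_triangle hΩ hc (γ s) (γ l₁) (γ t)
        have a4 : |s - l₁| + |l₁ - t| = |s - t| := by
          rw [abs_of_nonpos (by linarith), abs_of_nonpos (by linarith), abs_of_nonpos (by linarith)]
          ring
        linarith
    intro s hs t ht
    rcases le_total s t with h | h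
    · exact key s hs t ht h
    · rw [kobDist_comm, abs_sub_comm]
      exact key t ht s hs h

theorem DiscChain.exists_unitSpeedPath (hΩ : IsOpen Ω) (hc : IsConnected Ω) {z w : CSpace d} {L : ℝ}
    (h : DiscChain Ω z w L) : ∀ x y : Ω, (x : CSpace d) = z → (y : CSpace d) = w →
      ∃ γ, IsUnitSpeedPath Ω L γ x y := by
  induction h with
  | nil z =>
    rintro x y rfl hxy
    obtain rfl := Subtype.ext hxy
    exact ⟨_, IsUnitSpeedPath.refl _⟩
  | @cons φ a b w L hφ ha hb h ih =>
    intro x y hx hy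
    obtain ⟨γ₁, h₁⟩ := hφ.exists_unitSpeedPath (x := x) (y := ⟨φ b, hφ.2 hb⟩) ha hb hx.symm rfl
    obtain ⟨γ₂, h₂⟩ := ih ⟨φ b, hφ.2 hb⟩ y rfl hy
    exact ⟨_, h₁.trans hΩ hc h₂⟩

/-- An almost minimal chain, traversed along the diameters of its discs. Barth's theorem, Hopf-Rinow
and the shadowing of quasi-geodesics all rest on it. -/
theorem exists_unitSpeedPath (hΩ : IsOpen Ω) (hc : IsConnected Ω) (x y : Ω) {ε : ℝ} (hε : 0 < ε) :
    ∃ l < kobDist Ω x y + ε, ∃ γ, IsUnitSpeedPath Ω l γ x y := by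
  obtain ⟨L, hL, h⟩ := exists_discChain_lt hΩ hc x y hε
  exact ⟨L, hL, h.exists_unitSpeedPath hΩ hc x y rfl rfl⟩

/-- **Barth's theorem**: the Kobayashi distance of a hyperbolic domain induces its topology. -/
theorem IsKobHyperbolic.isOpen_iff (h : IsKobHyperbolic Ω) (hΩ : IsOpen Ω) (hc : IsConnected Ω)
    (s : Set Ω) : IsOpen s ↔ ∀ x ∈ s, ∃ ε > 0, ∀ y, kobDist Ω x y < ε → y ∈ s := by
  constructor
  · intro hs x hx
    obtain ⟨U, hU, rfl⟩ := isOpen_induced_iff.1 hs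
    obtain ⟨r, hr, hrU⟩ := Metric.nhds_basis_closedBall.mem_iff.1 ((hU.inter hΩ).mem_nhds ⟨hx, x.2⟩)
    have hcpt : IsCompact ((↑) ⁻¹' Metric.sphere (x : CSpace d) r : Set Ω) := by
      rw [Subtype.isCompact_iff, image_preimage_eq_inter_range, Subtype.range_coe,
        inter_eq_self_of_subset_left]
      · exact isCompact_sphere _ _
      · exact Metric.sphere_subset_closedBall.trans (hrU.trans inter_subset_right)
    -- Hyperbolicity makes the distance from x positive on the sphere, and compactness bounds it
    -- below. The sphere is empty if d = 0, and then any δ will do.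
    obtain ⟨δ, hδ, hδS⟩ : ∃ δ > 0, ∀ y : Ω, dist (y : CSpace d) x = r → δ ≤ kobDist Ω x y := by
      rcases ((↑) ⁻¹' Metric.sphere (x : CSpace d) r : Set Ω).eq_empty_or_nonempty with h0 | h0
      · refine ⟨1, one_pos, fun y hy => ?_⟩
        have : y ∈ ((↑) ⁻¹' Metric.sphere (x : CSpace d) r : Set Ω) := hy
        rw [h0] at this
        exact this.elim
      · obtain ⟨y₀, hy₀, hmin⟩ := hcpt.exists_isMinOn h0 (continuous_kobDist hΩ hc x).continuousOn
        refine ⟨kobDist Ω x y₀, lt_of_le_of_ne (kobDist_nonneg _ _) fun h00 => ?_, fun y hy => hmin hy⟩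
        have hxy := h x y₀ h00.symm
        rw [mem_preimage, ← hxy, Metric.mem_sphere, dist_self] at hy₀
        exact hr.ne hy₀
    refine ⟨δ, hδ, fun y hy => ?_⟩
    -- A path of length below δ that left the ball would cross the sphere, at distance at least δ
    -- from x.
    obtain ⟨l, hl, γ, hγ⟩ := exists_unitSpeedPath hΩ hc x y (sub_pos.2 hy)
    by_contra hyU
    have hyr : r ≤ dist (y : CSpace d) x := by
      by_contra! hlt
      exact hyU (hrU (Metric.mem_closedBall.2 hlt.le)).1
    obtain ⟨C, hC⟩ := hγ.lipschitz
    have hcont : ContinuousOn (fun t => dist (γ t : CSpace d) x) (Icc 0 l) :=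
      (continuous_id.dist continuous_const).comp_continuousOn hC.continuousOn
    obtain ⟨t, ht, htr⟩ := intermediate_value_Icc hγ.nonneg hcont (show r ∈ Icc _ _ by
      simp only [hγ.source, hγ.target, dist_self]
      exact ⟨hr.le, hyr⟩)
    have h1 := hδS (γ t) htr
    have h2 := hγ.kobDist_le 0 ⟨le_rfl, hγ.nonneg⟩ t ht
    rw [hγ.source, zero_sub, abs_neg, abs_of_nonneg ht.1] at h2
    linarith [ht.2]
  · intro hs
    rw [isOpen_iff_mem_nhds]
    intro x hx
    obtain ⟨ε, hε, hεs⟩ := hs x hx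
    filter_upwards [eventually_kobDist_lt hΩ x hε] with y hy using hεs y hy

theorem IsCompleteKobHyperbolic.exists_geodesicSegment (h : IsCompleteKobHyperbolic Ω)
    (hΩ : IsOpen Ω) (hc : IsConnected Ω) (w z : Ω) :
    ∃ σ, IsGeodesicSegment Ω (kobDist Ω w z) σ w z := by
  have : LocallyCompactSpace Ω := hΩ.locallyCompactSpace
  obtain ⟨σ, h0, h1, hσ⟩ := exists_geodesic_of_dist (kobDist Ω) kobDist_self kobDist_comm
    (kobDist_triangle hΩ hc) h.1 (h.1.isOpen_iff hΩ hc) h.2 (fun x y ε hε => by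
      obtain ⟨l, hl, γ, hγ⟩ := exists_unitSpeedPath hΩ hc x y hε
      exact ⟨l, γ, hγ.nonneg, hl, hγ.source, hγ.target, hγ.kobDist_le⟩) w z
  exact ⟨σ, kobDist_nonneg _ _, h0, h1, hσ⟩

end KobayashiDistance

/-! ### Shadowing quasi-geodesics by almost-geodesics. -/

section AlmostGeodesics

variable {d : ℕ} {Ω : Set (CSpace d)}

/-- Points with bounded consecutive distances are joined by a path of unit speed that passes from
each of them to the next one in bounded time. -/
theorem exists_unitSpeedPath_through (hΩ : IsOpen Ω) (hc : IsConnected Ω) {M : ℝ} (hM : 0 ≤ M)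
    (x : ℕ → Ω) (N : ℕ) (hx : ∀ i < N, kobDist Ω (x i) (x (i + 1)) < M) :
    ∃ (l : ℝ) (γ : ℝ → Ω) (τ : ℕ → ℝ), IsUnitSpeedPath Ω l γ (x 0) (x N) ∧ τ N = l ∧
      (∀ i ≤ N, τ i ∈ Icc 0 l ∧ γ (τ i) = x i) ∧
      (∀ i j, i ≤ j → j ≤ N → τ i ≤ τ j ∧ τ j - τ i ≤ M * (j - i)) ∧
      ∀ s ∈ Icc 0 l, ∃ i ≤ N, τ i ≤ s ∧ s ≤ τ i + M := by
  induction N with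
  | zero =>
    refine ⟨0, fun _ => x 0, fun _ => 0, IsUnitSpeedPath.refl _, rfl, ?_, ?_, ?_⟩
    · intro i hi
      obtain rfl : i = 0 := by omega
      simp
    · intro i j hij hj
      obtain rfl : j = 0 := by omega
      obtain rfl : i = 0 := by omega
      simp
    · intro s hs
      exact ⟨0, le_rfl, hs.1, by linarith [hs.2]⟩
  | succ N ih =>
    obtain ⟨l₁, γ₁, τ, h₁, hτN, hτ, hτM, hs⟩ := ih fun i hi => hx i (by omega)
    -- The slack is M minus the distance, so the new piece is shorter than M.
    obtain ⟨l₂, hl₂, γ₂, h₂⟩ := exists_unitSpeedPath hΩ hc (x N) (x (N + 1))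
      (sub_pos.2 (hx N (by omega)))
    have hl₂' : l₂ ≤ M := by linarith
    have hn₁ := h₁.nonneg
    have hn₂ := h₂.nonneg
    refine ⟨l₁ + l₂, _, fun i => if i ≤ N then τ i else l₁ + l₂, h₁.trans hΩ hc h₂,
      if_neg (by omega), ?_, ?_, ?_⟩
    · intro i hi
      by_cases hiN : i ≤ N
      · obtain ⟨ha, hb⟩ := hτ i hiN
        simp only [if_pos hiN, if_pos ha.2]
        exact ⟨⟨ha.1, by linarith [ha.2]⟩, hb⟩
      · obtain rfl : i = N + 1 := by omega
        simp only [if_neg hiN]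
        exact ⟨⟨by linarith, le_rfl⟩, (h₁.trans hΩ hc h₂).target⟩
    · intro i j hij hj
      by_cases hjN : j ≤ N
      · simp only [if_pos hjN, if_pos (hij.trans hjN)]
        exact hτM i j hij hjN
      · obtain rfl : j = N + 1 := by omega
        by_cases hiN : i ≤ N
        · simp only [if_pos hiN, if_neg hjN]
          have := (hτM i N hiN le_rfl).2
          rw [hτN] at this
          push_cast
          exact ⟨by linarith [(hτ i hiN).1.2], by linarith⟩
        · obtain rfl : i = N + 1 := by omega
          simp
    · intro s hsl
      rcases le_total s l₁ with h | h
      · obtain ⟨i, hi, ha⟩ := hs s ⟨hsl.1, h⟩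
        exact ⟨i, by omega, by simpa only [if_pos hi] using ha⟩
      · refine ⟨N, by omega, ?_⟩
        simp only [if_pos le_rfl, hτN]
        exact ⟨h, by linarith [hsl.2]⟩

/-- Every quasi-geodesic is shadowed by an almost-geodesic with the same end points. -/
theorem exists_almostGeodesic_near (hΩ : IsOpen Ω) (hc : IsConnected Ω) {lam κ T : ℝ}
    (hlam : 1 ≤ lam) (hκ : 0 ≤ κ) (hT : 0 ≤ T) (g : ℝ → Ω)
    (hg : ∀ s ∈ Icc 0 T, ∀ t ∈ Icc 0 T, lam⁻¹ * |t - s| - κ ≤ kobDist Ω (g t) (g s) ∧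
      kobDist Ω (g t) (g s) ≤ lam * |t - s| + κ) :
    ∃ (l : ℝ) (γ : ℝ → Ω), 0 ≤ l ∧
      IsAlmostGeodesic Ω (lam * (lam + κ + 1)) (2 + κ + 2 * (lam + κ + 1)) l γ ∧
      γ 0 = g 0 ∧ γ l = g T ∧
      ∀ s ∈ Icc 0 l, ∃ t ∈ Icc 0 T, kobDist Ω (γ s) (g t) ≤ lam + κ + 1 := by
  -- Samples at times at most 1 apart are at distance at most lam + κ; the extra 1 makes the
  -- inequality strict.
  set M := lam + κ + 1 with hM
  have hM1 : 1 ≤ M := by linarith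
  let N := ⌈T⌉₊
  let p : ℕ → ℝ := fun i => min i T
  have hp : ∀ i, p i ∈ Icc 0 T := fun i => ⟨le_min (by positivity) hT, min_le_right _ _⟩
  have hstep : ∀ i, |p (i + 1) - p i| ≤ 1 := by
    intro i
    simp only [p]
    push_cast
    rw [abs_le]
    rcases min_cases ((i : ℝ) + 1) T with ⟨h1, h1'⟩ | ⟨h1, h1'⟩ <;>
    rcases min_cases (i : ℝ) T with ⟨h2, h2'⟩ | ⟨h2, h2'⟩ <;>
    rw [h1, h2] <;> constructor <;> linarith
  obtain ⟨l, γ, τ, hγ, hτN, hτ, hτM, hs⟩ := exists_unitSpeedPath_through hΩ hc (M := M)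
    (by linarith) (fun i => g (p i)) N (by
      intro i _
      rw [kobDist_comm]
      have h1 := (hg _ (hp i) _ (hp (i + 1))).2
      have h2 := mul_le_mul_of_nonneg_left (hstep i) (zero_le_one.trans hlam)
      linarith)
  have hp0 : p 0 = 0 := by simp [p, hT]
  have hpN : p N = T := min_eq_right (Nat.le_ceil T)
  -- The last sampling interval may be shorter than 1, hence the loss of 1.
  have hgap : ∀ i j, i ≤ j → j ≤ N → ((j : ℝ) - i) - 1 ≤ p j - p i := by
    intro i j _ hj
    have h1 : p i ≤ i := min_le_left _ _
    have h2 : (j : ℝ) ≤ N := by exact_mod_cast hj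
    have h3 : (j : ℝ) - 1 ≤ p j := le_min (by linarith) (by linarith [Nat.ceil_lt_add_one hT])
    linarith
  -- Moving γ s and γ t to the preceding samples costs 2M, and κ comes from g. The 2 bounds lam⁻¹
  -- times the difference between j - i + 1, which controls |t - s| / M, and j - i - 1 from `hgap`.
  have hlow : ∀ i j, i ≤ j → j ≤ N → ∀ s ∈ Icc 0 l, ∀ t ∈ Icc 0 l, τ i ≤ s → s ≤ τ i + M →
      τ j ≤ t → t ≤ τ j + M →
      (lam * M)⁻¹ * |t - s| - (2 + κ + 2 * M) ≤ kobDist Ω (γ t) (γ s) := by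
    intro i j hij hj s hs t ht h1 h2 h3 h4
    have a1 := hγ.kobDist_le _ (hτ i (hij.trans hj)).1 s hs
    have a2 := hγ.kobDist_le _ (hτ j hj).1 t ht
    rw [(hτ i (hij.trans hj)).2, abs_of_nonpos (by linarith)] at a1
    rw [(hτ j hj).2, abs_of_nonpos (by linarith)] at a2
    have a3 := (hg _ (hp i) _ (hp j)).1
    have a4 := kobDist_triangle hΩ hc (g (p j)) (γ t) (g (p i))
    have a5 := kobDist_triangle hΩ hc (γ t) (γ s) (g (p i))
    rw [kobDist_comm (γ s)] at a5
    have a6 := (hgap i j hij hj).trans (le_abs_self _)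
    have a7 := hτM i j hij hj
    have hij' : (i : ℝ) ≤ j := by exact_mod_cast hij
    have a8 : |t - s| ≤ M * (j - i) + M := by
      have := mul_nonneg (zero_le_one.trans hM1) (sub_nonneg.2 hij')
      rw [abs_le]
      constructor <;> linarith [a7.1, a7.2]
    have hinv : 0 < lam⁻¹ := by positivity
    have hinv1 : lam⁻¹ ≤ 1 := inv_le_one_of_one_le₀ hlam
    have a9 : (lam * M)⁻¹ * |t - s| ≤ lam⁻¹ * (j - i + 1) := by
      rw [mul_inv, mul_assoc]
      refine mul_le_mul_of_nonneg_left ?_ hinv.le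
      rw [inv_mul_le_iff₀ (by linarith)]
      linarith
    have a10 : lam⁻¹ * (j - i - 1) ≤ lam⁻¹ * |p j - p i| := mul_le_mul_of_nonneg_left a6 hinv.le
    nlinarith
  have hlM : 1 ≤ lam * M := one_le_mul_of_one_le_of_one_le hlam hM1
  refine ⟨l, γ, hγ.nonneg, ⟨fun s hs' t ht' => ⟨?_, ?_⟩, ?_, ?_⟩, by rw [hγ.source, hp0],
    by rw [hγ.target, hpN], fun s hs' => ?_⟩
  · obtain ⟨i, hi, hi1, hi2⟩ := hs s hs'
    obtain ⟨j, hj, hj1, hj2⟩ := hs t ht'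
    rcases le_total i j with h | h
    · exact hlow i j h hj s hs' t ht' hi1 hi2 hj1 hj2
    · rw [abs_sub_comm, kobDist_comm]
      exact hlow j i h hi t ht' s hs' hj1 hj2 hi1 hi2
  · have h1 := hγ.kobDist_le t ht' s hs'
    have h2 := mul_le_mul_of_nonneg_right hlM (abs_nonneg (t - s))
    linarith
  · obtain ⟨C, hC⟩ := hγ.lipschitz
    rw [← uIcc_of_le hγ.nonneg] at hC
    exact hC.absolutelyContinuousOnInterval
  · filter_upwards [hγ.kobMetric_le] with t ht using ht.trans hlM
  · obtain ⟨i, hi, hi1, hi2⟩ := hs s hs'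
    refine ⟨p i, hp i, ?_⟩
    have h1 := hγ.kobDist_le s hs' _ (hτ i hi).1
    rw [(hτ i hi).2, abs_of_nonneg (by linarith)] at h1
    linarith

end AlmostGeodesics

/-! ### Boundary limits of f and the continuous extension. -/

section Extension

variable {d : ℕ} {Ω : Set (CSpace d)}

theorem toClosureEnd_eq_comp (Ω : Set (CSpace d)) :
    toClosureEnd Ω = EndCompactification.pt ∘ inclusion subset_closure := rfl

theorem isDenseInducing_toClosureEnd (Ω : Set (CSpace d)) : IsDenseInducing (toClosureEnd Ω) := by
  refine ⟨?_, ?_⟩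
  · exact isOpenEmbedding_pt.isInducing.comp (IsEmbedding.inclusion subset_closure).isInducing
  · exact denseRange_pt.comp ((denseRange_inclusion_iff subset_closure).2 Subset.rfl) continuous_pt

theorem connectedSpace_closure (hc : IsConnected Ω) : ConnectedSpace (closure Ω) :=
  isConnected_iff_connectedSpace.1 hc.closure

theorem isCountablyGenerated_comap_toClosureEnd (hc : IsConnected Ω) (ξ : ClosureEnd Ω) :
    (comap (toClosureEnd Ω) (𝓝 ξ)).IsCountablyGenerated := by
  have := connectedSpace_closure hc
  have : LocallyCompactSpace (closure Ω) := isClosed_closure.locallyCompactSpace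
  have := isCountablyGenerated_comap_pt ξ
  rw [toClosureEnd_eq_comp, ← comap_comap]
  infer_instance

theorem exists_tendsto_toClosureEnd (hc : IsConnected Ω) (U : Ultrafilter Ω) :
    ∃ η, Tendsto (toClosureEnd Ω) U (𝓝 η) := by
  have := connectedSpace_closure hc
  have : LocallyCompactSpace (closure Ω) := isClosed_closure.locallyCompactSpace
  exact exists_tendsto_pt (U.map (inclusion subset_closure))

instance (Ω : Set (CSpace d)) : T3Space (ClosureEnd Ω) := by
  have : LocallyCompactSpace (closure Ω) := isClosed_closure.locallyCompactSpace
  infer_instance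

/-- The Kobayashi distance to a fixed point tends to infinity at the boundary of a domain with
well-behaved geodesics. -/
theorem HasWellBehavedGeodesics.tendsto_kobDist (h : HasWellBehavedGeodesics Ω) (hΩ : IsOpen Ω)
    (hc : IsConnected Ω) {ξ : ClosureEnd Ω} (hξ : ξ ∈ endBoundary Ω) (o : Ω) :
    Tendsto (kobDist Ω o) (comap (toClosureEnd Ω) (𝓝 ξ)) atTop := by
  have := isCountablyGenerated_comap_toClosureEnd hc ξ
  rw [tendsto_iff_seq_tendsto]
  intro z hz
  have hz' := tendsto_comap_iff.1 hz
  -- Constant geodesics, of length 0, already detect the divergence. The base point o' depends on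
  -- the sequence, and passing to o costs only K_Ω(o', o).
  obtain ⟨o', ho'⟩ := h.2 ξ hξ z z hz' hz' (fun _ => 0) (fun n _ => z n) fun n =>
    ⟨le_rfl, rfl, rfl, fun s hs t ht => by
      obtain rfl : s = 0 := le_antisymm hs.2 hs.1
      obtain rfl : t = 0 := le_antisymm ht.2 ht.1
      simp [kobDist_self]⟩
  simp only [Icc_self, image_singleton, csInf_singleton] at ho'
  refine tendsto_atTop_mono (fun n => ?_) (tendsto_atTop_add_const_right _ (-kobDist Ω o' o) ho')
  have := kobDist_triangle hΩ hc o' o (z n)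
  simp only [Function.comp_apply]
  linarith

variable {d₁ d₂ : ℕ} {Ω₁ : Set (CSpace d₁)} {Ω₂ : Set (CSpace d₂)} {f : Ω₁ → Ω₂}

/-- Cluster points of `f` at the boundary of `Ω₁` lie in the boundary of `Ω₂`. -/
theorem IsKobQuasiIsometricEmbedding.mem_endBoundary (hf : IsKobQuasiIsometricEmbedding Ω₁ Ω₂ f)
    (hΩ₁ : IsOpen Ω₁) (hc₁ : IsConnected Ω₁) (hΩ₂ : IsOpen Ω₂) (hc₂ : IsConnected Ω₂)
    (h₁ : HasWellBehavedGeodesics Ω₁) {ξ : ClosureEnd Ω₁} (hξ : ξ ∈ endBoundary Ω₁)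
    {l : Filter Ω₁} [l.NeBot] (hl : l ≤ comap (toClosureEnd Ω₁) (𝓝 ξ)) {η : ClosureEnd Ω₂}
    (hη : Tendsto (fun z => toClosureEnd Ω₂ (f z)) l (𝓝 η)) : η ∈ endBoundary Ω₂ := by
  rintro ⟨y, rfl⟩
  obtain ⟨lam, κ, hlam, hκ, hq⟩ := hf
  obtain ⟨o⟩ := hc₁.nonempty.to_subtype
  have hfy : Tendsto f l (𝓝 y) := by
    rw [(isDenseInducing_toClosureEnd Ω₂).nhds_eq_comap, tendsto_comap_iff]
    exact hη
  have h1 : Tendsto (fun z => kobDist Ω₂ (f o) (f z)) l (𝓝 (kobDist Ω₂ (f o) y)) :=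
    ((continuous_kobDist hΩ₂ hc₂ (f o)).tendsto y).comp hfy
  have h2 : Tendsto (fun z => lam⁻¹ * kobDist Ω₁ o z - κ) l atTop :=
    tendsto_atTop_add_const_right _ _
      (((h₁.tendsto_kobDist hΩ₁ hc₁ hξ o).mono_left hl).const_mul_atTop (by positivity))
  exact not_tendsto_nhds_of_tendsto_atTop (tendsto_atTop_mono (fun z => (hq o z).1) h2) _ h1

/-- Two sequences that converge to the same boundary point of `Ω₁` cannot be mapped by `f` into
neighbourhoods with disjoint closures of two boundary points of `Ω₂`. -/
theorem IsKobQuasiIsometricEmbedding.not_separated (hf : IsKobQuasiIsometricEmbedding Ω₁ Ω₂ f)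
    (hΩ₁ : IsOpen Ω₁) (hc₁ : IsConnected Ω₁) (hΩ₂ : IsOpen Ω₂) (hc₂ : IsConnected Ω₂)
    (h₁ : HasWellBehavedGeodesics Ω₁) (h₂ : IsVisibilityDomain Ω₂)
    {ξ : ClosureEnd Ω₁} (hξ : ξ ∈ endBoundary Ω₁) {z w : ℕ → Ω₁}
    (hz : Tendsto (fun n => toClosureEnd Ω₁ (z n)) atTop (𝓝 ξ))
    (hw : Tendsto (fun n => toClosureEnd Ω₁ (w n)) atTop (𝓝 ξ))
    {η ζ : ClosureEnd Ω₂} (hη : η ∈ endBoundary Ω₂) (hζ : ζ ∈ endBoundary Ω₂) (hne : η ≠ ζ)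
    {V W : Set (ClosureEnd Ω₂)} (hV : IsOpen V) (hW : IsOpen W) (hηV : η ∈ V) (hζW : ζ ∈ W)
    (hVW : Disjoint (closure V) (closure W)) (hwV : ∀ n, toClosureEnd Ω₂ (f (w n)) ∈ V)
    (hzW : ∀ n, toClosureEnd Ω₂ (f (z n)) ∈ W) : False := by
  obtain ⟨lam, κ, hlam, hκ, hq⟩ := hf
  set M := lam + κ + 1 with hM
  have hM1 : 1 ≤ M := by linarith
  choose σ hσ using fun n => h₁.1.exists_geodesicSegment hΩ₁ hc₁ (w n) (z n)
  obtain ⟨o, ho⟩ := h₁.2 ξ hξ z w hz hw _ σ hσ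
  obtain ⟨K, hK, hKΩ, hvis⟩ := h₂.2 (lam * M) (2 + κ + 2 * M)
    (one_le_mul_of_one_le_of_one_le hlam hM1) (by linarith) η hη ζ hζ hne V W hV hW hηV hζW hVW
  have hK' : IsCompact ((↑) ⁻¹' K : Set Ω₂) := by
    rw [Subtype.isCompact_iff, image_preimage_eq_inter_range, Subtype.range_coe,
      inter_eq_self_of_subset_left hKΩ]
    exact hK
  obtain ⟨R, hR⟩ := hK'.bddAbove_image (continuous_kobDist hΩ₂ hc₂ (f o)).continuousOn
  -- R bounds the distance from f o to K and M the distance to the shadowing path; κ and lam come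
  -- from the lower quasi-isometry bound.
  obtain ⟨n, hn⟩ := (ho.eventually_gt_atTop (lam * (R + M + κ))).exists
  obtain ⟨hT, hσ0, hσT, hgeo⟩ := hσ n
  obtain ⟨l, γ, hl, hγ, hγ0, hγl, hnear⟩ := exists_almostGeodesic_near hΩ₂ hc₂ hlam hκ hT
    (fun t => f (σ n t)) fun s hs t ht => by
      have := hq (σ n t) (σ n s)
      rwa [hgeo s hs t ht] at this
  obtain ⟨s, hs, hsK⟩ := hvis l γ hl hγ (by rw [hγ0, hσ0]; exact hwV n)
    (by rw [hγl, hσT]; exact hzW n)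
  obtain ⟨t, ht, hst⟩ := hnear s hs
  have b1 : kobDist Ω₂ (f o) (γ s) ≤ R := hR (mem_image_of_mem _ hsK)
  have b2 := kobDist_triangle hΩ₂ hc₂ (f o) (γ s) (f (σ n t))
  have b3 := (hq o (σ n t)).1
  have b4 : sInf ((fun t => kobDist Ω₁ o (σ n t)) '' Icc 0 (kobDist Ω₁ (w n) (z n))) ≤
      kobDist Ω₁ o (σ n t) := by
    refine csInf_le ⟨0, ?_⟩ (mem_image_of_mem _ ht)
    rintro _ ⟨t', -, rfl⟩
    exact kobDist_nonneg _ _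
  have b5 : lam⁻¹ * kobDist Ω₁ o (σ n t) ≤ R + M + κ := by linarith
  rw [inv_mul_le_iff₀ (by linarith)] at b5
  linarith

/-- One ultrafilter finer than the trace supplies the limit η. Any other has a limit too, and if it
differed from η, sequences near the two limits would contradict `not_separated`. -/
theorem IsKobQuasiIsometricEmbedding.exists_tendsto (hf : IsKobQuasiIsometricEmbedding Ω₁ Ω₂ f)
    (hΩ₁ : IsOpen Ω₁) (hc₁ : IsConnected Ω₁) (hΩ₂ : IsOpen Ω₂) (hc₂ : IsConnected Ω₂)
    (h₁ : HasWellBehavedGeodesics Ω₁) (h₂ : IsVisibilityDomain Ω₂) {ξ : ClosureEnd Ω₁}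
    (hξ : ξ ∈ endBoundary Ω₁) :
    ∃ η, Tendsto (fun z => toClosureEnd Ω₂ (f z)) (comap (toClosureEnd Ω₁) (𝓝 ξ)) (𝓝 η) := by
  have := isCountablyGenerated_comap_toClosureEnd hc₁ ξ
  have := (isDenseInducing_toClosureEnd Ω₁).comap_nhds_neBot ξ
  set l := comap (toClosureEnd Ω₁) (𝓝 ξ) with hl
  obtain ⟨η, hη⟩ := exists_tendsto_toClosureEnd hc₂ ((Ultrafilter.of l).map f)
  replace hη : Tendsto (fun z => toClosureEnd Ω₂ (f z)) (Ultrafilter.of l) (𝓝 η) := hη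
  refine ⟨η, tendsto_iff_ultrafilter _ _ _ |>.2 fun U hU => ?_⟩
  obtain ⟨ζ, hζ⟩ := exists_tendsto_toClosureEnd hc₂ (U.map f)
  replace hζ : Tendsto (fun z => toClosureEnd Ω₂ (f z)) U (𝓝 ζ) := hζ
  by_cases hne : η = ζ
  · exact hne ▸ hζ
  exfalso
  obtain ⟨V, hηV, hV, W, hζW, hW, hVW⟩ := exists_open_nhds_disjoint_closure hne
  -- A set that is frequent along l contains the terms of a sequence tending to l, because l is
  -- countably generated; l' itself need not be.
  have hseq : ∀ {l' : Filter Ω₁} [l'.NeBot] {θ : ClosureEnd Ω₂} {A : Set (ClosureEnd Ω₂)}, l' ≤ l →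
      Tendsto (fun z => toClosureEnd Ω₂ (f z)) l' (𝓝 θ) → IsOpen A → θ ∈ A →
      ∃ z : ℕ → Ω₁, Tendsto (fun n => toClosureEnd Ω₁ (z n)) atTop (𝓝 ξ) ∧
        ∀ n, toClosureEnd Ω₂ (f (z n)) ∈ A := by
    intro l' _ θ A hl' hθ hA hθA
    obtain ⟨z, hz, hzA⟩ := exists_seq_forall_of_frequently
      (((hθ.eventually (hA.mem_nhds hθA)).frequently).filter_mono hl')
    have hz' : Tendsto (toClosureEnd Ω₁ ∘ z) atTop (𝓝 ξ) := tendsto_comap.comp hz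
    exact ⟨z, hz', hzA⟩
  obtain ⟨w, hw, hwV⟩ := hseq (Ultrafilter.of_le l) hη hV hηV
  obtain ⟨z, hz, hzW⟩ := hseq hU hζ hW hζW
  exact hf.not_separated hΩ₁ hc₁ hΩ₂ hc₂ h₁ h₂ hξ hz hw
    (hf.mem_endBoundary hΩ₁ hc₁ hΩ₂ hc₂ h₁ hξ (Ultrafilter.of_le l) hη)
    (hf.mem_endBoundary hΩ₁ hc₁ hΩ₂ hc₂ h₁ hξ hU hζ) hne hV hW hηV hζW hVW hwV hzW

end Extension

theorem theorem1p2 {d₁ d₂ : ℕ} (Ω₁ : Set (CSpace d₁)) (Ω₂ : Set (CSpace d₂))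
    (hΩ₁_open : IsOpen Ω₁) (hΩ₁_conn : IsConnected Ω₁)
    (hΩ₂_open : IsOpen Ω₂) (hΩ₂_conn : IsConnected Ω₂)
    (h₁ : HasWellBehavedGeodesics Ω₁) (h₂ : IsVisibilityDomain Ω₂)
    (f : Ω₁ → Ω₂) (hf_cont : Continuous f) (hf : IsKobQuasiIsometricEmbedding Ω₁ Ω₂ f) :
    ∃ F : ClosureEnd Ω₁ → ClosureEnd Ω₂,
      Continuous F ∧ ∀ z : Ω₁, F (toClosureEnd Ω₁ z) = toClosureEnd Ω₂ (f z) := by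
  have di := isDenseInducing_toClosureEnd Ω₁
  have hg : Continuous fun z => toClosureEnd Ω₂ (f z) :=
    (isDenseInducing_toClosureEnd Ω₂).continuous.comp hf_cont
  -- In a regular target, limits along all the traces are enough for the extension by density to be
  -- continuous.
  refine ⟨di.extend fun z => toClosureEnd Ω₂ (f z), di.continuous_extend fun ξ => ?_,
    fun z => di.extend_eq hg z⟩
  by_cases hξ : ξ ∈ endBoundary Ω₁
  · exact hf.exists_tendsto hΩ₁_open hΩ₁_conn hΩ₂_open hΩ₂_conn h₁ h₂ hξ
  · obtain ⟨z, rfl⟩ := not_not.1 hξ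
    exact ⟨_, di.nhds_eq_comap z ▸ hg.tendsto z⟩
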